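/- A (finite, weighted) cell complex $K=(X,\delta,m)$ consists of a finite set $X=\bigsqcup_{k\ge 0}X_k$ of cells ($\dim x=k$ for $x\in X_k$), a linear operator $\delta:C(X)\to C(X)$ on $C(X)=\mathbb R^X$ and a weight $m:X\to(0,\infty)$. Write $x$ also for the indicator function $1_x$, and $x\lessdot z$ if $\delta x(z)\neq 0$. It is required that $\delta v(z)\in\{-1,0,1\}$; that $v\lessdot z$ implies $\dim z=\dim v+1$; that every $z$ with $\dim z\ge 1$ has some $x\lessdot z$; and that (i) each $x\in X_1$ has exactly one $w\in X_0$ with $\delta w(x)=1$ and exactly one with $\delta w(x)=-1$; (ii) if $\dim z=\dim v+2$ and $v\lessdot x\lessdot z$ for some $x$, then there are exactly two such $x$, and $\delta v(x)\,\delta x(z)$ takes both values $\pm1$; (iii) if $\dim z\ge 2$ and $x,y\lessdot z$, then $x$ and $y$ are joined by a sequence of proper faces of $z$ in which consecutive cells are incident (one is $\lessdot$ the other); (iv) if $\dim z\ge1$ and $\{x:x\lessdot z\}=\{x:x\lessdot z'\}$, then $z=z'$. Let $\delta^*$ be the adjoint of $\delta$ with respect to $\langle f,g\rangle=\sum_x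 f(x)g(x)m(x)$, and $H=\delta\delta^*+\delta^*\delta$. For $\omega:X\to(0,\infty)$ put \[ F_{K,\omega}(x)=Hx(x)-\sum_{y\ne x}\frac{\omega(y)}{\omega(x)}\,|Hy(x)|,\qquad \omega(x)\,\kappa_\omega(x)=\inf_{\substack{f\in C(X)\\ \delta f(x)=\omega(x),\ |\delta f|\le\omega}}\delta\delta^*\delta f(x). \] A 1-dimensional cell complex is a weighted graph. Call $\omega$ non-degenerate if every edge is the unique shortest path between its two vertices, where the length of a path is the sum of $\omega$ over its edges. A 2-cell $z\gtrdot x$, $x\in X_1$, is shortcutting for $x$ if $\sum_{y\lessdot z}\omega(y)<2\sum_{y\lessdot z,\ \delta\delta^*x(y)\ne0}\omega(y)$. **Corollary.** Let $G=(X,\delta,m)$ be a 1-dimensional cell complex and let $\omega:X\to(0,\infty)$ be non-degenerate. Then for every edge $x\in X_1$ \[ \kappa_\omega(x)=\max_K F_{K,\omega}(x), \] where the maximum is attained and is taken over all cell complexes $K$ having $G$ as 1-skeleton ($\omega$ being extended arbitrarily to a positive function on the cells of $K$, on which $F_{K,\omega}(x)$ does not depend). The same holds if $K$ ranges only over such complexes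 of dimension at most $2$, or only over such complexes of dimension at most $2$ all of whose 2-cells are shortcutting for $x$. Moreover, let $K=(X,\delta,m)$ be any cell complex, $w:X\to(0,\infty)$, $m=1/w$ and $\omega=\sqrt w$. Then $F_{K,\omega}(x)=F_{\mathrm{original}}(x)/w(x)$ for every cell $x$, where $F_{\mathrm{original}}$ is Forman's original curvature for the cell weights $w$, \[ \frac{F_{\mathrm{original}}(x)}{w(x)}=\sum_{v\lessdot x}\frac{w(v)}{w(x)}+\sum_{z\gtrdot x}\frac{w(x)}{w(z)}-\sum_{y\ne x}\Bigl|\sum_{v\lessdot x,y}\delta v(x)\delta v(y)\frac{w(v)}{\sqrt{w(y)w(x)}}+\sum_{z\gtrdot x,y}\delta x(z)\delta y(z)\frac{\sqrt{w(x)w(y)}}{w(z)}\Bigr| . \] If $x\in X_1$ and, for each $y\neq x$, the product $\delta x(z)\,\delta y(z)$ is the same for all $z\gtrdot x,y$, then also \[ \frac{F_{\mathrm{original}}(x)}{w(x)}=\sum_{v\lessdot x}\frac{w(v)}{w(x)}+\sum_{z\gtrdot x}\frac{w(x)}{w(z)}-\sum_{y\ne x}\Bigl|\sum_{v\lessdot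 x,y}\frac{w(v)}{\sqrt{w(y)w(x)}}-\sum_{z\gtrdot x,y}\frac{\sqrt{w(x)w(y)}}{w(z)}\Bigr| . \] -/

import Mathlib

universe u

/-- A finite weighted cell complex `(X, δ, m)` in the combinatorial sense. The coboundary operator is
given by its matrix: `inc v z` is the incidence number `δv(z)` (the value at `z` of the coboundary of
the indicator function of `v`), so `inc v z ≠ 0` says that `v` is a facet of `z`. -/
structure CellComplex (X : Type u) [Fintype X] where
  dim : X → ℕ
  inc : X → X → ℝ
  m : X → ℝ
  m_pos : ∀ x, 0 < m x
  inc_mem : ∀ v z, inc v z = -1 ∨ inc v z = 0 ∨ inc v z = 1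
  dim_eq : ∀ v z, inc v z ≠ 0 → dim z = dim v + 1
  exists_facet : ∀ z, 1 ≤ dim z → ∃ x, inc x z ≠ 0
  /-- every edge has exactly one head and exactly one tail -/
  edge_head : ∀ x, dim x = 1 → ∃! w, dim w = 0 ∧ inc w x = 1
  edge_tail : ∀ x, dim x = 1 → ∃! w, dim w = 0 ∧ inc w x = -1
  /-- the diamond property -/
  diamond_card : ∀ v z, dim z = dim v + 2 → (∃ x, inc v x ≠ 0 ∧ inc x z ≠ 0) →
    Set.ncard {x | inc v x ≠ 0 ∧ inc x z ≠ 0} = 2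
  diamond_sign : ∀ v z, dim z = dim v + 2 → (∃ x, inc v x ≠ 0 ∧ inc x z ≠ 0) →
    (∃ x, inc v x * inc x z = 1) ∧ (∃ x, inc v x * inc x z = -1)
  /-- the boundary of a cell of dimension at least two is connected: any two facets of `z` are joined
  by a sequence of proper faces of `z` in which consecutive cells are incident -/
  boundary_connected : ∀ z, 2 ≤ dim z → ∀ x y, inc x z ≠ 0 → inc y z ≠ 0 →
    Relation.ReflTransGen
      (fun a b =>
        Relation.TransGen (fun c d => inc c d ≠ 0) a z ∧
        Relation.TransGen (fun c d => inc c d ≠ 0) b z ∧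
        inc a b + inc b a ≠ 0) x y
  /-- a cell of positive dimension is determined by its facets -/
  eq_of_facets : ∀ z z', 1 ≤ dim z → {x | inc x z ≠ 0} = {x | inc x z' ≠ 0} → z = z'

namespace CellComplex

variable {X : Type u} [Fintype X]

/-- All cells have dimension at most `n`. -/
def DimLE (K : CellComplex X) (n : ℕ) : Prop := ∀ x, K.dim x ≤ n

/-- The coboundary operator `δ : C(X) → C(X)`. -/
def coboundary (K : CellComplex X) : (X → ℝ) →ₗ[ℝ] (X → ℝ) where
  toFun f z := ∑ v, f v * K.inc v z
  map_add' f g := by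
    funext z
    simp [add_mul, Finset.sum_add_distrib]
  map_smul' c f := by
    funext z
    simp [Finset.mul_sum, mul_assoc]

/-- The operator `δ*`, the adjoint of `δ` for `⟨f, g⟩ = ∑ x, f x * g x * m x`
(see `inner_coboundary`). -/
noncomputable def coboundaryAdj (K : CellComplex X) : (X → ℝ) →ₗ[ℝ] (X → ℝ) where
  toFun f x := ∑ z, f z * (K.m z / K.m x * K.inc x z)
  map_add' f g := by
    funext z
    simp [add_mul, Finset.sum_add_distrib]
  map_smul' c f := by
    funext z
    simp [Finset.mul_sum, mul_assoc]

theorem inner_coboundary (K : CellComplex X) (f g : X → ℝ) :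
    ∑ z, K.coboundary f z * g z * K.m z = ∑ x, f x * K.coboundaryAdj g x * K.m x := by
  simp only [coboundary, coboundaryAdj, LinearMap.coe_mk, AddHom.coe_mk, Finset.sum_mul,
    Finset.mul_sum]
  rw [Finset.sum_comm]
  refine Finset.sum_congr rfl fun x _ => Finset.sum_congr rfl fun z _ => ?_
  have h := (K.m_pos x).ne'
  field_simp

/-- The Hodge Laplacian `H = δ δ* + δ* δ`. -/
noncomputable def hodge (K : CellComplex X) : (X → ℝ) →ₗ[ℝ] (X → ℝ) :=
  K.coboundary ∘ₗ K.coboundaryAdj + K.coboundaryAdj ∘ₗ K.coboundary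

open Classical in
/-- The indicator function of a cell. -/
noncomputable def ind (x : X) : X → ℝ := fun y => if y = x then 1 else 0

open Classical in
/-- The generalized Forman curvature
`F_ω(x) = Hx(x) - ∑_{y ≠ x} (ω(y) / ω(x)) * |Hy(x)|`. -/
noncomputable def forman (K : CellComplex X) (ω : X → ℝ) (x : X) : ℝ :=
  K.hodge (ind x) x - ∑ y with y ≠ x, ω y / ω x * |K.hodge (ind y) x|

/-- The Ollivier curvature `κ_ω(x)`, given by
`ω(x) κ_ω(x) = inf {δδ*δf(x) : δf(x) = ω(x), |δf| ≤ ω}`; the infimum is taken in the extended reals,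
so it is `⊤` if there is no such `f`. -/
noncomputable def ollivier (K : CellComplex X) (ω : X → ℝ) (x : X) : EReal :=
  (⨅ (f : X → ℝ) (_ : K.coboundary f x = ω x ∧ ∀ y, |K.coboundary f y| ≤ ω y),
    ((K.coboundary (K.coboundaryAdj (K.coboundary f)) x : ℝ) : EReal)) / ((ω x : ℝ) : EReal)

/-- `K.EdgePath v w p`: the list `p` of edges is a path in the 1-skeleton from the vertex `v` to the
vertex `w`. -/
inductive EdgePath (K : CellComplex X) : X → X → List X → Prop
  | nil (v : X) : K.dim v = 0 → EdgePath K v v []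
  | cons (v v' w x : X) (p : List X) : K.dim x = 1 → K.inc v x ≠ 0 → K.inc v' x ≠ 0 → v ≠ v' →
      EdgePath K v' w p → EdgePath K v w (x :: p)

/-- Every edge is the unique shortest path between its two vertices, where the length of a path is the
sum of the values of `ω` on its edges. -/
def NonDegenerate (K : CellComplex X) (ω : X → ℝ) : Prop :=
  ∀ x v w, K.dim x = 1 → K.inc v x ≠ 0 → K.inc w x ≠ 0 → v ≠ w →
    ∀ p, K.EdgePath v w p → p ≠ [x] → ω x < (p.map ω).sum

open Classical in
/-- The 2-cell `z` is a cycle through the edge `x` that is shortcutting: the total length of `z` is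
less than twice the total length of those edges of `z` that are equal or adjacent to `x`. -/
def IsShortcutting (K : CellComplex X) (ω : X → ℝ) (x z : X) : Prop :=
  K.dim z = 2 ∧ K.inc x z ≠ 0 ∧
    ∑ y with K.inc y z ≠ 0, ω y <
      2 * ∑ y with K.inc y z ≠ 0 ∧ K.coboundary (K.coboundaryAdj (ind x)) y ≠ 0, ω y

/-- The map `ι` identifies `G` with the `k`-skeleton of `K`. -/
structure IsSkeleton {Y : Type u} [Fintype Y] (k : ℕ) (G : CellComplex X) (K : CellComplex Y)
    (ι : X → Y) : Prop where
  injective : Function.Injective ι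
  mem_range : ∀ y, y ∈ Set.range ι ↔ K.dim y ≤ k
  dim_eq : ∀ x, K.dim (ι x) = G.dim x
  inc_eq : ∀ v x, K.inc (ι v) (ι x) = G.inc v x
  m_eq : ∀ x, K.m (ι x) = G.m x

/-- A cell complex `K` having `G` as its 1-skeleton, together with a positive function on the cells of
`K` that agrees with `ω` on the cells of `G`. (The Forman curvature of an edge does not depend on the
values of this function on the cells of dimension at least two.) -/
structure Extension (G : CellComplex X) (ω : X → ℝ) where
  Y : Type u
  [fintypeY : Fintype Y]
  K : CellComplex Y
  ι : X → Y
  isSkeleton : IsSkeleton 1 G K ι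
  ω' : Y → ℝ
  ω'_pos : ∀ y, 0 < ω' y
  ω'_eq : ∀ x, ω' (ι x) = ω x

attribute [instance] Extension.fintypeY

/-- The Forman curvature `F_{K,ω}(x)` of an edge `x` of `G` in the complex `K` having `G` as its
1-skeleton. -/
noncomputable def Extension.curv {G : CellComplex X} {ω : X → ℝ} (E : Extension G ω) (x : X) : ℝ :=
  E.K.forman E.ω' (E.ι x)

open Classical in
/-- Forman's original curvature for cell weights `w`, on cells of any dimension:
`w(x)` times the difference between
`∑_{v ⋖ x} w(v)/w(x) + ∑_{z ⋗ x} w(x)/w(z)` and the sum over all `y ≠ x` of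
`|∑_{v ⋖ x,y} δv(x) δv(y) w(v)/√(w(y)w(x)) + ∑_{z ⋗ x,y} δx(z) δy(z) √(w(x)w(y))/w(z)|`. -/
noncomputable def formanOriginal (K : CellComplex X) (w : X → ℝ) (x : X) : ℝ :=
  w x * ((∑ v with K.inc v x ≠ 0, w v / w x) + (∑ z with K.inc x z ≠ 0, w x / w z)
    - ∑ y with y ≠ x,
      |(∑ v with K.inc v x ≠ 0 ∧ K.inc v y ≠ 0,
          K.inc v x * K.inc v y * (w v / √(w y * w x)))
        + ∑ z with K.inc x z ≠ 0 ∧ K.inc y z ≠ 0,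
          K.inc x z * K.inc y z * (√(w x * w y) / w z)|)

open Classical in
/-- The expression for Forman's original curvature of an edge that does not involve orientations:
here the absolute values are
`|∑_{v ⋖ x,y} w(v)/√(w(y)w(x)) - ∑_{z ⋗ x,y} √(w(x)w(y))/w(z)|`. -/
noncomputable def formanOriginalEdge (K : CellComplex X) (w : X → ℝ) (x : X) : ℝ :=
  w x * ((∑ v with K.inc v x ≠ 0, w v / w x) + (∑ z with K.inc x z ≠ 0, w x / w z)
    - ∑ y with y ≠ x,
      |(∑ v with K.inc v x ≠ 0 ∧ K.inc v y ≠ 0, w v / √(w y * w x))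
        - ∑ z with K.inc x z ≠ 0 ∧ K.inc y z ≠ 0, √(w x * w y) / w z|)

/-- For every cell `y ≠ x`, all cells containing both `x` and `y` as facets induce the same relative
orientation of `x` and `y`. -/
def Coherent (K : CellComplex X) (x : X) : Prop :=
  ∀ y z z', y ≠ x → K.inc x z ≠ 0 → K.inc y z ≠ 0 → K.inc x z' ≠ 0 → K.inc y z' ≠ 0 →
    K.inc x z * K.inc y z = K.inc x z' * K.inc y z'

end CellComplex

/-! The lower bound. Let `K` have 1-skeleton `G` and let `g = δf`. Since `δδ = 0`, the upper
Laplacian kills `g`, so `δδ*g(x) = Hg(x)`. If `g(x) = ω(x)` and `|g| ≤ ω`, each off-diagonal term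
`Hy(x) g(y)` is at least `-ω(y)|Hy(x)|`, whence `δδ*δf(x) ≥ ω(x) F_{K,ω}(x)`. Thus no extension
beats the infimum (`Extension.curv_mul_le`).

Equality is linear programming duality. Drop the condition that `g` is a coboundary and keep only
`|g| ≤ ω`, `g(x) = ω(x)` and `∑ s(y) g(y) ≤ 0` for the signed shortcutting cycles `s` through `x`.
This relaxation does not lower the infimum. Indeed `δδ*g(x)` involves only edges at the endpoints of
`x`, so `g` matters only through the values it prescribes at the neighbours of these endpoints. The
cycle inequalities make these values compatible with the path metric of `ω`
(`pathCompatible_of_shortCycle`), non-degeneracy disposes of paths through the endpoints of `x`, and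
a McShane extension yields a potential that does at least as well
(`PathCompatible.exists_feasible`).

Farkas' lemma now supplies multipliers `c ≥ 0` for the cycles (`exists_weights`). Attaching a 2-cell
along each cycle with `c > 0`, with mass `c m(x)`, adds exactly `∑ c s` to row `x` of `H`.
Minimising the resulting linear form over the box gives `ω(x) F_{K,ω}(x)`, so this complex attains
the infimum.

The statements on Forman's original curvature are a substitution, together with the diamond property
to control signs. -/

/-! ### Farkas' lemma -/

/-- Farkas' lemma for finitely many linear functionals. -/
theorem exists_nonneg_combination_of_forall_nonpos {ι V : Type*} [AddCommGroup V] [Module ℝ V]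
    (s : Finset ι) : ∀ (a : ι → V →ₗ[ℝ] ℝ) (b : V →ₗ[ℝ] ℝ),
      (∀ g, (∀ i ∈ s, a i g ≤ 0) → b g ≤ 0) →
      ∃ c : ι → ℝ, (∀ i, 0 ≤ c i) ∧ b = ∑ i ∈ s, c i • a i := by
  classical
  induction s using Finset.induction_on with
  | empty =>
    intro a b h
    refine ⟨0, fun _ => le_rfl, ?_⟩
    ext g
    have h1 := h g (by simp)
    have h2 := h (-g) (by simp)
    simp only [map_neg] at h2
    simp only [Finset.sum_empty, LinearMap.zero_apply]
    linarith
  | insert j s hj ih =>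
    intro a b h
    by_cases h0 : ∀ g, (∀ i ∈ s, a i g ≤ 0) → b g ≤ 0
    · obtain ⟨c, hc, hb⟩ := ih a b h0
      refine ⟨Function.update c j 0, fun i => ?_, ?_⟩
      · by_cases hi : i = j
        · subst hi; simp
        · simp [hi, hc]
      · rw [Finset.sum_insert hj, Function.update_self, zero_smul, zero_add, hb]
        refine Finset.sum_congr rfl fun i hi => ?_
        rw [Function.update_of_ne (by rintro rfl; exact hj hi)]
    · push Not at h0
      obtain ⟨y, hy, hby⟩ := h0
      have hjy : 0 < a j y := by
        by_contra hle
        refine absurd (h y fun i hi => ?_) hby.not_ge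
        rcases Finset.mem_insert.1 hi with rfl | hi
        · exact not_lt.1 hle
        · exact hy i hi
      set t : ℝ := (a j y)⁻¹ with ht
      have ht0 : 0 < t := inv_pos.2 hjy
      have htj : t * a j y = 1 := inv_mul_cancel₀ hjy.ne'
      -- Without the constraint `j` the implication fails at `y`, so `a j y > 0`. The induction
      -- hypothesis is applied to the functionals composed with the projection onto `ker (a j)`
      -- along `y`.
      obtain ⟨c, hc, hb⟩ := ih (fun i => a i - (t * a i y) • a j) (b - (t * b y) • a j) (by
        intro g hg
        have := h (g - (t * a j g) • y) (by
          intro i hi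
          simp only [map_sub, map_smul, smul_eq_mul]
          rcases Finset.mem_insert.1 hi with rfl | hi
          · have : t * a i g * a i y = a i g := by
              rw [mul_right_comm, htj, one_mul]
            rw [this, sub_self]
          · have := hg i hi
            simp only [LinearMap.sub_apply, LinearMap.smul_apply, smul_eq_mul] at this
            linarith [mul_right_comm t (a i y) (a j g)])
        simp only [map_sub, map_smul, smul_eq_mul] at this
        simp only [LinearMap.sub_apply, LinearMap.smul_apply, smul_eq_mul]
        linarith [mul_right_comm t (b y) (a j g)])
      -- The coefficient of `a j` collects what the projection subtracted. It is nonnegative because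
      -- `b y > 0` and `a i y ≤ 0` for `i ∈ s`.
      refine ⟨Function.update c j (t * b y - ∑ i ∈ s, c i * (t * a i y)), fun i => ?_, ?_⟩
      · by_cases hi : i = j
        · subst hi
          rw [Function.update_self, sub_nonneg]
          have h1 : ∑ i ∈ s, c i * (t * a i y) ≤ 0 :=
            Finset.sum_nonpos fun i hi => mul_nonpos_of_nonneg_of_nonpos (hc i)
              (mul_nonpos_of_nonneg_of_nonpos ht0.le (hy i hi))
          exact h1.trans (mul_pos ht0 hby).le
        · simp [hi, hc]
      · rw [Finset.sum_insert hj, Function.update_self]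
        have h2 : ∑ i ∈ s, Function.update c j (t * b y - ∑ i ∈ s, c i * (t * a i y)) i • a i
            = ∑ i ∈ s, c i • a i := Finset.sum_congr rfl fun i hi => by
          rw [Function.update_of_ne (by rintro rfl; exact hj hi)]
        rw [h2]
        refine (sub_eq_iff_eq_add.1 hb).trans (LinearMap.ext fun g => ?_)
        simp only [LinearMap.add_apply, LinearMap.sum_apply, LinearMap.smul_apply,
          LinearMap.sub_apply, smul_eq_mul, mul_sub, Finset.sum_sub_distrib, sub_mul,
          Finset.sum_mul, mul_assoc]
        ring

/-! ### Matrix entries of the Laplacians -/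

namespace CellComplex

variable {X : Type u} [Fintype X]

/-- The matrix of `δ δ*`: the value at `x` of `δ δ* 1_y`. -/
noncomputable def lowerLap (K : CellComplex X) (x y : X) : ℝ :=
  ∑ v, K.m y / K.m v * K.inc v y * K.inc v x

/-- The matrix of `δ* δ`: the value at `x` of `δ* δ 1_y`. -/
noncomputable def upperLap (K : CellComplex X) (x y : X) : ℝ :=
  ∑ z, K.m z / K.m x * K.inc y z * K.inc x z

theorem coboundary_apply (K : CellComplex X) (f : X → ℝ) (z : X) :
    K.coboundary f z = ∑ v, f v * K.inc v z := rfl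

theorem coboundaryAdj_apply (K : CellComplex X) (f : X → ℝ) (x : X) :
    K.coboundaryAdj f x = ∑ z, f z * (K.m z / K.m x * K.inc x z) := rfl

theorem lowerLap_apply (K : CellComplex X) (g : X → ℝ) (x : X) :
    K.coboundary (K.coboundaryAdj g) x = ∑ y, K.lowerLap x y * g y := by
  simp only [coboundary_apply, coboundaryAdj_apply, lowerLap, Finset.sum_mul]
  rw [Finset.sum_comm]
  exact Finset.sum_congr rfl fun y _ => Finset.sum_congr rfl fun v _ => by ring

theorem upperLap_apply (K : CellComplex X) (g : X → ℝ) (x : X) :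
    K.coboundaryAdj (K.coboundary g) x = ∑ y, K.upperLap x y * g y := by
  simp only [coboundary_apply, coboundaryAdj_apply, upperLap, Finset.sum_mul]
  rw [Finset.sum_comm]
  exact Finset.sum_congr rfl fun y _ => Finset.sum_congr rfl fun v _ => by ring

theorem sum_mul_ind (F : X → ℝ) (y : X) : ∑ z, F z * ind y z = F y := by
  classical
  simp [ind]

theorem lowerLap_ind (K : CellComplex X) (x y : X) :
    K.coboundary (K.coboundaryAdj (ind y)) x = K.lowerLap x y := by
  rw [lowerLap_apply, sum_mul_ind]

theorem hodge_ind (K : CellComplex X) (x y : X) :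
    K.hodge (ind y) x = K.lowerLap x y + K.upperLap x y := by
  simp only [hodge, LinearMap.add_apply, LinearMap.comp_apply, Pi.add_apply, lowerLap_ind,
    upperLap_apply, sum_mul_ind]

theorem forman_eq [DecidableEq X] (K : CellComplex X) (ω : X → ℝ) (x : X) :
    K.forman ω x = K.lowerLap x x + K.upperLap x x
      - ∑ y with y ≠ x, ω y / ω x * |K.lowerLap x y + K.upperLap x y| := by
  simp only [forman, hodge_ind]
  congr!

theorem lowerLap_eq_zero (K : CellComplex X) {x y : X} (h : K.dim y ≠ K.dim x) :
    K.lowerLap x y = 0 := by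
  refine Finset.sum_eq_zero fun v _ => ?_
  by_contra hne
  have h1 : K.inc v y ≠ 0 := fun h0 => hne (by simp [h0])
  have h2 : K.inc v x ≠ 0 := fun h0 => hne (by simp [h0])
  exact h (by rw [K.dim_eq _ _ h1, K.dim_eq _ _ h2])

theorem upperLap_eq_zero (K : CellComplex X) {x y : X} (h : K.dim y ≠ K.dim x) :
    K.upperLap x y = 0 := by
  refine Finset.sum_eq_zero fun z _ => ?_
  by_contra hne
  have h1 : K.inc y z ≠ 0 := fun h0 => hne (by simp [h0])
  have h2 : K.inc x z ≠ 0 := fun h0 => hne (by simp [h0])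
  have := K.dim_eq _ _ h1
  have := K.dim_eq _ _ h2
  omega

theorem inc_cases (K : CellComplex X) {v z : X} (h : K.inc v z ≠ 0) :
    K.inc v z = 1 ∨ K.inc v z = -1 := by
  rcases K.inc_mem v z with h1 | h1 | h1
  · exact Or.inr h1
  · exact absurd h1 h
  · exact Or.inl h1

/-- `δ ∘ δ = 0`, in terms of incidence numbers. -/
theorem sum_inc_mul_inc (K : CellComplex X) (v z : X) : ∑ x, K.inc v x * K.inc x z = 0 := by
  classical
  by_cases hex : ∃ x, K.inc v x ≠ 0 ∧ K.inc x z ≠ 0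
  · obtain ⟨x, hx1, hx2⟩ := hex
    have hd : K.dim z = K.dim v + 2 := by rw [K.dim_eq _ _ hx2, K.dim_eq _ _ hx1]
    have hc := K.diamond_card v z hd ⟨x, hx1, hx2⟩
    obtain ⟨⟨a, ha⟩, ⟨b, hb⟩⟩ := K.diamond_sign v z hd ⟨x, hx1, hx2⟩
    have hab : a ≠ b := by rintro rfl; rw [ha] at hb; norm_num at hb
    have hS : {x | K.inc v x ≠ 0 ∧ K.inc x z ≠ 0} = {a, b} := by
      symm
      apply Set.eq_of_subset_of_ncard_le _ _ (Set.toFinite _)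
      · rintro y (rfl | rfl)
        · exact ⟨fun h => by simp [h] at ha, fun h => by simp [h] at ha⟩
        · exact ⟨fun h => by simp [h] at hb, fun h => by simp [h] at hb⟩
      · rw [hc, Set.ncard_pair hab]
    rw [← Finset.sum_subset (Finset.subset_univ {a, b}), Finset.sum_pair hab, ha, hb]
    · norm_num
    · intro y _ hy
      by_contra hne
      have : y ∈ ({a, b} : Set X) := by
        rw [← hS]
        exact ⟨left_ne_zero_of_mul hne, right_ne_zero_of_mul hne⟩
      exact hy (by simpa using this)
  · push Not at hex
    refine Finset.sum_eq_zero fun x _ => ?_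
    by_cases h : K.inc v x = 0
    · simp [h]
    · simp [hex x h]

theorem coboundary_coboundary (K : CellComplex X) (f : X → ℝ) :
    K.coboundary (K.coboundary f) = 0 := by
  funext z
  simp only [coboundary_apply, Finset.sum_mul, Pi.zero_apply]
  rw [Finset.sum_comm]
  refine Finset.sum_eq_zero fun v _ => ?_
  simp only [mul_assoc, ← Finset.mul_sum, sum_inc_mul_inc, mul_zero]

/-! ### Forman curvature as a lower bound -/

/-- The generalized Forman curvature is a lower bound for `δδ*δf(x) / ω(x)`. -/
theorem forman_mul_le (K : CellComplex X) {ω : X → ℝ} (hω : ∀ y, 0 < ω y) (x : X) (f : X → ℝ)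
    (hx : K.coboundary f x = ω x)
    (hf : ∀ y, K.dim y = K.dim x → |K.coboundary f y| ≤ ω y) :
    K.forman ω x * ω x ≤ K.coboundary (K.coboundaryAdj (K.coboundary f)) x := by
  classical
  set g := K.coboundary f with hg
  -- Because `δδ = 0`, the term `δ*δg(x)` can be added for free, turning `δδ*` into `H`.
  have h0 : K.coboundaryAdj (K.coboundary g) x = 0 := by
    rw [hg, coboundary_coboundary]; simp
  have h1 : K.coboundary (K.coboundaryAdj g) x
      = ∑ y, (K.lowerLap x y + K.upperLap x y) * g y := by
    simp only [add_mul, Finset.sum_add_distrib, ← lowerLap_apply, ← upperLap_apply, h0, add_zero]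
  rw [h1, forman_eq, sub_mul, Finset.sum_mul, Finset.filter_ne', sub_le_iff_le_add,
    ← Finset.add_sum_erase _ _ (Finset.mem_univ x), hx, add_assoc, ← Finset.sum_add_distrib]
  refine le_add_of_nonneg_right (Finset.sum_nonneg fun y _ => ?_)
  set A := K.lowerLap x y + K.upperLap x y with hA
  have hωx := (hω x).ne'
  have e : ω y / ω x * |A| * ω x = ω y * |A| := by field_simp
  rw [e]
  by_cases hd : K.dim y = K.dim x
  · have h2 : |A * g y| ≤ ω y * |A| := by
      rw [abs_mul, mul_comm]
      exact mul_le_mul_of_nonneg_right (hf y hd) (abs_nonneg _)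
    linarith [neg_abs_le (A * g y)]
  · rw [hA, lowerLap_eq_zero _ hd, upperLap_eq_zero _ hd]
    simp

theorem IsSkeleton.coboundary_extend {Y : Type u} [Fintype Y] {k : ℕ} {G : CellComplex X}
    {K : CellComplex Y} {ι : X → Y} (h : IsSkeleton k G K ι) (f : X → ℝ) (x : X) :
    K.coboundary (Function.extend ι f 0) (ι x) = G.coboundary f x := by
  classical
  rw [coboundary_apply, coboundary_apply]
  rw [← Finset.sum_subset (Finset.subset_univ (Finset.univ.image ι)),
    Finset.sum_image h.injective.injOn]
  · simp only [h.injective.extend_apply, h.inc_eq]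
  · intro y _ hy
    rw [Function.extend_apply' _ _ _ (by simpa using hy)]
    simp

/-- The lower Laplacian sees only facets, which stay in the skeleton; higher cells affect only
`δ*δ`. -/
theorem IsSkeleton.lowerLap_eq {Y : Type u} [Fintype Y] {k : ℕ} {G : CellComplex X}
    {K : CellComplex Y} {ι : X → Y} (h : IsSkeleton k G K ι) (x y : X) :
    K.lowerLap (ι x) (ι y) = G.lowerLap x y := by
  classical
  rw [lowerLap, lowerLap]
  rw [← Finset.sum_subset (Finset.subset_univ (Finset.univ.image ι)),
    Finset.sum_image h.injective.injOn]
  · simp only [h.m_eq, h.inc_eq]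
  · intro v _ hv
    suffices K.inc v (ι x) = 0 by simp [this]
    by_contra hne
    have h1 : K.dim (ι x) ≤ k := (h.mem_range _).1 ⟨x, rfl⟩
    have h2 := K.dim_eq _ _ hne
    obtain ⟨w, rfl⟩ := (h.mem_range v).2 (by omega)
    simp at hv

theorem IsSkeleton.sum_lowerLap {Y : Type u} [Fintype Y] {k : ℕ} {G : CellComplex X}
    {K : CellComplex Y} {ι : X → Y} (h : IsSkeleton k G K ι) (g : Y → ℝ) (x : X) :
    ∑ y, K.lowerLap (ι x) y * g y = ∑ y, G.lowerLap x y * g (ι y) := by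
  classical
  rw [← Finset.sum_subset (Finset.subset_univ (Finset.univ.image ι)),
    Finset.sum_image h.injective.injOn]
  · simp only [h.lowerLap_eq]
  · intro y _ hy
    rw [lowerLap_eq_zero, zero_mul]
    intro hd
    have h1 : K.dim (ι x) ≤ k := (h.mem_range _).1 ⟨x, rfl⟩
    obtain ⟨w, rfl⟩ := (h.mem_range y).2 (by omega)
    simp at hy

/-- Every extension of `G` gives a lower bound for the values in the definition of the Ollivier
curvature. -/
theorem Extension.curv_mul_le {G : CellComplex X} {ω : X → ℝ} (E : G.Extension ω) {x : X}
    (hdx : G.dim x = 1) (f : X → ℝ) (hx : G.coboundary f x = ω x)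
    (hf : ∀ y, |G.coboundary f y| ≤ ω y) :
    E.curv x * ω x ≤ G.coboundary (G.coboundaryAdj (G.coboundary f)) x := by
  -- Extend `f` by zero. The bound is needed only in dimension 1, where every cell of the extension
  -- comes from `G`.
  have h := E.K.forman_mul_le E.ω'_pos (E.ι x) (Function.extend E.ι f 0)
    (by rw [E.isSkeleton.coboundary_extend, hx, E.ω'_eq]) (by
      intro y hy
      rw [E.isSkeleton.dim_eq, hdx] at hy
      obtain ⟨y, rfl⟩ := (E.isSkeleton.mem_range y).2 hy.le
      rw [E.isSkeleton.coboundary_extend, E.ω'_eq]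
      exact hf y)
  rw [E.ω'_eq, lowerLap_apply, E.isSkeleton.sum_lowerLap] at h
  simp only [E.isSkeleton.coboundary_extend] at h
  rwa [lowerLap_apply]

/-! ### Orientations and Forman's original curvature -/

theorem edge_facets (K : CellComplex X) {x : X} (hx : K.dim x = 1) :
    ∃ a b, K.dim a = 0 ∧ K.dim b = 0 ∧ a ≠ b ∧ K.inc a x = -1 ∧ K.inc b x = 1 ∧
      ∀ v, K.inc v x ≠ 0 ↔ v = a ∨ v = b := by
  obtain ⟨b, ⟨hb0, hb⟩, hbu⟩ := K.edge_head x hx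
  obtain ⟨a, ⟨ha0, ha⟩, hau⟩ := K.edge_tail x hx
  refine ⟨a, b, ha0, hb0, ?_, ha, hb, fun v => ⟨fun hv => ?_, ?_⟩⟩
  · rintro rfl
    rw [ha] at hb; norm_num at hb
  · have hd : K.dim v = 0 := by have := K.dim_eq _ _ hv; omega
    rcases K.inc_cases hv with h | h
    · exact Or.inr (hbu v ⟨hd, h⟩)
    · exact Or.inl (hau v ⟨hd, h⟩)
  · rintro (rfl | rfl)
    · rw [ha]; norm_num
    · rw [hb]; norm_num

/-- Two edges with two common vertices are equal. -/
theorem edge_eq_of_two_facets (K : CellComplex X) {x y a b : X} (hx : K.dim x = 1) (hab : a ≠ b)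
    (hax : K.inc a x ≠ 0) (hbx : K.inc b x ≠ 0) (hay : K.inc a y ≠ 0) (hby : K.inc b y ≠ 0) :
    x = y := by
  have hy : K.dim y = 1 := by rw [K.dim_eq _ _ hay, ← K.dim_eq _ _ hax, hx]
  apply K.eq_of_facets x y hx.ge
  obtain ⟨a1, b1, -, -, -, -, -, h1⟩ := K.edge_facets hx
  obtain ⟨a2, b2, -, -, -, -, -, h2⟩ := K.edge_facets hy
  ext v
  simp only [Set.mem_ofPred_eq, h1, h2]
  rw [h1] at hax hbx
  rw [h2] at hay hby
  grind

/-- If `x ≠ y` have a common facet `v` and a common coface `z`, then the relative orientations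
induced by `v` and by `z` are opposite. -/
theorem inc_mul_inc_eq_neg (K : CellComplex X) {x y v z : X} (hxy : x ≠ y) (hvx : K.inc v x ≠ 0)
    (hvy : K.inc v y ≠ 0) (hxz : K.inc x z ≠ 0) (hyz : K.inc y z ≠ 0) :
    K.inc v x * K.inc v y = -(K.inc x z * K.inc y z) := by
  classical
  have hd : K.dim z = K.dim v + 2 := by rw [K.dim_eq _ _ hxz, K.dim_eq _ _ hvx]
  have hc := K.diamond_card v z hd ⟨x, hvx, hxz⟩
  have hS : {x | K.inc v x ≠ 0 ∧ K.inc x z ≠ 0} = {x, y} := by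
    symm
    apply Set.eq_of_subset_of_ncard_le _ _ (Set.toFinite _)
    · rintro y (rfl | rfl)
      · exact ⟨hvx, hxz⟩
      · exact ⟨hvy, hyz⟩
    · rw [hc, Set.ncard_pair hxy]
  have hsum := K.sum_inc_mul_inc v z
  rw [← Finset.sum_subset (Finset.subset_univ {x, y}), Finset.sum_pair hxy] at hsum
  · revert hsum
    rcases K.inc_cases hvx with h1 | h1 <;> rcases K.inc_cases hvy with h2 | h2 <;>
      rcases K.inc_cases hxz with h3 | h3 <;> rcases K.inc_cases hyz with h4 | h4 <;>
      rw [h1, h2, h3, h4] <;> norm_num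
  · intro u _ hu
    by_contra hne
    have : u ∈ ({x, y} : Set X) := by
      rw [← hS]
      exact ⟨left_ne_zero_of_mul hne, right_ne_zero_of_mul hne⟩
    exact hu (by simpa using this)

/-- For `m = 1/w`, the factor `√w(y)/√w(x)` symmetrises both Laplacian entries: `w(v)/w(y)` becomes
`w(v)/√(w(y)w(x))`, and `w(x)/w(z)` becomes `√(w(x)w(y))/w(z)`. -/
theorem forman_sqrt_eq (K : CellComplex X) {w : X → ℝ} (hw : ∀ x, 0 < w x)
    (hm : ∀ x, K.m x = 1 / w x) (x : X) :
    K.forman (fun y => √(w y)) x = K.formanOriginal w x / w x := by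
  classical
  have hne := fun y => (hw y).ne'
  have key : ∀ y, √(w y) / √(w x) * (K.lowerLap x y + K.upperLap x y) =
      (∑ v with K.inc v x ≠ 0 ∧ K.inc v y ≠ 0,
          K.inc v x * K.inc v y * (w v / √(w y * w x)))
        + ∑ z with K.inc x z ≠ 0 ∧ K.inc y z ≠ 0,
          K.inc x z * K.inc y z * (√(w x * w y) / w z) := by
    intro y
    have hsx := (Real.sqrt_pos.2 (hw x)).ne'
    have hsy := (Real.sqrt_pos.2 (hw y)).ne'
    have ex := Real.mul_self_sqrt (hw x).le
    have ey := Real.mul_self_sqrt (hw y).le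
    rw [mul_add, lowerLap, upperLap, Finset.mul_sum, Finset.mul_sum]
    congr 1
    · rw [Finset.sum_filter_of_ne]
      · refine Finset.sum_congr rfl fun v _ => ?_
        rw [hm, hm, Real.sqrt_mul (hw y).le]
        have := hne v
        have := hne y
        field_simp
        rw [sq, ey]
      · intro v _ h
        exact ⟨left_ne_zero_of_mul (left_ne_zero_of_mul h),
          right_ne_zero_of_mul (left_ne_zero_of_mul h)⟩
    · rw [Finset.sum_filter_of_ne]
      · refine Finset.sum_congr rfl fun v _ => ?_
        rw [hm, hm, Real.sqrt_mul (hw x).le]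
        have := hne v
        have := hne x
        field_simp
        rw [sq, ex]
      · intro v _ h
        exact ⟨left_ne_zero_of_mul (left_ne_zero_of_mul h),
          right_ne_zero_of_mul (left_ne_zero_of_mul h)⟩
  have h1 : ∀ v z, K.inc v z ≠ 0 → K.inc v z * K.inc v z = 1 := by
    intro v z h
    rcases K.inc_cases h with h | h <;> rw [h] <;> norm_num
  rw [forman_eq, formanOriginal, mul_div_cancel_left₀ _ (hne x)]
  congr 1
  · rw [lowerLap, upperLap]
    congr 1
    · rw [← Finset.sum_filter_of_ne (p := fun v => K.inc v x ≠ 0)]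
      · refine Finset.sum_congr (by congr!) fun v hv => ?_
        rw [mul_assoc, h1 v x (Finset.mem_filter.1 hv).2, hm, hm]
        have := hne v
        have := hne x
        field_simp
      · intro v _ h
        exact right_ne_zero_of_mul h
    · rw [← Finset.sum_filter_of_ne (p := fun z => K.inc x z ≠ 0)]
      · refine Finset.sum_congr (by congr!) fun v hv => ?_
        rw [mul_assoc, h1 x v (Finset.mem_filter.1 hv).2, hm, hm]
        have := hne v
        have := hne x
        field_simp
      · intro v _ h
        exact right_ne_zero_of_mul h
  · refine Finset.sum_congr (by congr!) fun y _ => ?_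
    have hnn : 0 ≤ √(w y) / √(w x) := by positivity
    rw [← abs_of_nonneg hnn, ← abs_mul, key]

/-- All incidence products for a fixed `y` share one sign up to the minus between the two sums. Two
distinct edges have at most one common vertex, coherence fixes the sign over the common cofaces, and
the diamond property makes the two signs opposite. The common sign `η` disappears in the absolute
value. -/
theorem formanOriginal_eq_edge (K : CellComplex X) (w : X → ℝ) {x : X} (hx : K.dim x = 1)
    (hc : K.Coherent x) : K.formanOriginal w x = K.formanOriginalEdge w x := by
  classical
  rw [formanOriginal, formanOriginalEdge]
  congr 2
  refine Finset.sum_congr rfl fun y hy => ?_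
  have hyx : y ≠ x := (Finset.mem_filter.1 hy).2
  obtain ⟨η, hη, hv, hz⟩ : ∃ η : ℝ, |η| = 1 ∧
      (∀ v, K.inc v x ≠ 0 → K.inc v y ≠ 0 → K.inc v x * K.inc v y = η) ∧
      (∀ z, K.inc x z ≠ 0 → K.inc y z ≠ 0 → K.inc x z * K.inc y z = -η) := by
    have habs : ∀ {a b c d}, K.inc a b ≠ 0 → K.inc c d ≠ 0 → |K.inc a b * K.inc c d| = 1 := by
      intro a b c d h h'
      rcases K.inc_cases h with h | h <;> rcases K.inc_cases h' with h' | h' <;> simp [h, h']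
    by_cases hex : ∃ z, K.inc x z ≠ 0 ∧ K.inc y z ≠ 0
    · obtain ⟨z, hxz, hyz⟩ := hex
      refine ⟨-(K.inc x z * K.inc y z), ?_, ?_, ?_⟩
      · rw [abs_neg, habs hxz hyz]
      · intro v hvx hvy
        exact K.inc_mul_inc_eq_neg hyx.symm hvx hvy hxz hyz
      · intro z' hxz' hyz'
        rw [neg_neg]
        exact hc y z' z hyx hxz' hyz' hxz hyz
    · push Not at hex
      by_cases hex' : ∃ v, K.inc v x ≠ 0 ∧ K.inc v y ≠ 0
      · obtain ⟨v, hvx, hvy⟩ := hex'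
        refine ⟨K.inc v x * K.inc v y, habs hvx hvy, ?_, fun z h1 h2 => absurd (hex z h1) h2⟩
        intro v' hvx' hvy'
        by_cases hvv : v' = v
        · rw [hvv]
        · exact absurd (K.edge_eq_of_two_facets hx hvv hvx' hvx hvy' hvy) hyx.symm
      · push Not at hex'
        exact ⟨1, abs_one, fun v h1 h2 => absurd (hex' v h1) h2,
          fun z h1 h2 => absurd (hex z h1) h2⟩
  rw [← one_mul |_ - _|, ← hη, ← abs_mul, mul_sub, Finset.mul_sum, Finset.mul_sum, sub_eq_add_neg,
    ← Finset.sum_neg_distrib]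
  congr 2
  · refine Finset.sum_congr rfl fun v h => ?_
    obtain ⟨h1, h2⟩ := (Finset.mem_filter.1 h).2
    rw [hv v h1 h2]
  · refine Finset.sum_congr rfl fun v h => ?_
    obtain ⟨h1, h2⟩ := (Finset.mem_filter.1 h).2
    rw [hz v h1 h2, neg_mul]

/-! ### Walks in the 1-skeleton: edges, lengths and chains -/

theorem inc_eq_neg_of_edge (K : CellComplex X) {a b y : X} (hy : K.dim y = 1) (hab : a ≠ b)
    (ha : K.inc a y ≠ 0) (hb : K.inc b y ≠ 0) : K.inc a y = -K.inc b y := by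
  obtain ⟨c, d, -, -, hcd, hc, hd, h⟩ := K.edge_facets hy
  rcases (h a).1 ha with rfl | rfl <;> rcases (h b).1 hb with rfl | rfl
  · exact absurd rfl hab
  · rw [hc, hd]
  · rw [hc, hd]; norm_num
  · exact absurd rfl hab

/-- The simple graph underlying the 1-skeleton. -/
def graph (K : CellComplex X) : SimpleGraph X where
  Adj a b := a ≠ b ∧ ∃ y, K.dim y = 1 ∧ K.inc a y ≠ 0 ∧ K.inc b y ≠ 0
  symm := ⟨fun _ _ ⟨h, y, hy, ha, hb⟩ => ⟨h.symm, y, hy, hb, ha⟩⟩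
  loopless := ⟨fun _ h => h.1 rfl⟩

/-- The edge joining two adjacent vertices. -/
noncomputable def edge (K : CellComplex X) {a b : X} (h : K.graph.Adj a b) : X := h.2.choose

section edge

variable (K : CellComplex X) {a b : X} (h : K.graph.Adj a b)

theorem dim_edge : K.dim (K.edge h) = 1 := h.2.choose_spec.1

theorem inc_left_edge : K.inc a (K.edge h) ≠ 0 := h.2.choose_spec.2.1

theorem inc_right_edge : K.inc b (K.edge h) ≠ 0 := h.2.choose_spec.2.2

theorem edge_eq {y : X} (ha : K.inc a y ≠ 0) (hb : K.inc b y ≠ 0) : K.edge h = y :=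
  K.edge_eq_of_two_facets (K.dim_edge h) h.1 (K.inc_left_edge h) (K.inc_right_edge h) ha hb

theorem inc_edge_iff (v : X) : K.inc v (K.edge h) ≠ 0 ↔ v = a ∨ v = b := by
  obtain ⟨c, d, -, -, hcd, -, -, hf⟩ := K.edge_facets (K.dim_edge h)
  have h1 := (hf a).1 (K.inc_left_edge h)
  have h2 := (hf b).1 (K.inc_right_edge h)
  have h3 := h.1
  rw [hf]
  grind

end edge

/-- The edges traversed by a walk. -/
noncomputable def edgeList (K : CellComplex X) {a b : X} (p : K.graph.Walk a b) : List X :=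
  p.darts.map fun d => K.edge d.adj

/-- The length of a walk. -/
noncomputable def len (K : CellComplex X) (ω : X → ℝ) {a b : X} (p : K.graph.Walk a b) : ℝ :=
  ((K.edgeList p).map ω).sum

open Classical in
/-- The 1-chain of a walk: the signed sum of its edges. -/
noncomputable def chain (K : CellComplex X) {a b : X} (p : K.graph.Walk a b) : X → ℝ :=
  (p.darts.map fun d => Pi.single (K.edge d.adj) (K.inc d.snd (K.edge d.adj))).sum

section walk

variable (K : CellComplex X) {a b c : X}

@[simp] theorem edgeList_nil : K.edgeList (.nil : K.graph.Walk a a) = [] := rfl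

@[simp] theorem edgeList_cons (h : K.graph.Adj a b) (p : K.graph.Walk b c) :
    K.edgeList (.cons h p) = K.edge h :: K.edgeList p := rfl

@[simp] theorem chain_nil : K.chain (.nil : K.graph.Walk a a) = 0 := by simp [chain]

open Classical in
theorem chain_cons (h : K.graph.Adj a b) (p : K.graph.Walk b c) :
    K.chain (.cons h p) = Pi.single (K.edge h) (K.inc b (K.edge h)) + K.chain p := by
  simp [chain]

@[simp] theorem len_nil (ω : X → ℝ) : K.len ω (.nil : K.graph.Walk a a) = 0 := by
  simp [len]

@[simp] theorem len_cons (ω : X → ℝ) (h : K.graph.Adj a b) (p : K.graph.Walk b c) :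
    K.len ω (.cons h p) = ω (K.edge h) + K.len ω p := by
  simp [len]

@[simp] theorem len_append (ω : X → ℝ) (p : K.graph.Walk a b) (q : K.graph.Walk b c) :
    K.len ω (p.append q) = K.len ω p + K.len ω q := by
  simp [len, edgeList, SimpleGraph.Walk.darts_append]

@[simp] theorem len_concat (ω : X → ℝ) (p : K.graph.Walk a b) (h : K.graph.Adj b c) :
    K.len ω (p.concat h) = K.len ω p + ω (K.edge h) := by
  simp [SimpleGraph.Walk.concat_eq_append]

theorem edgeList_concat (p : K.graph.Walk a b) (h : K.graph.Adj b c) :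
    K.edgeList (p.concat h) = K.edgeList p ++ [K.edge h] := by
  simp [edgeList, SimpleGraph.Walk.darts_concat]

theorem len_nonneg {ω : X → ℝ} (hω : ∀ y, 0 < ω y) (p : K.graph.Walk a b) : 0 ≤ K.len ω p := by
  refine List.sum_nonneg fun r hr => ?_
  obtain ⟨y, -, rfl⟩ := List.mem_map.1 hr
  exact (hω y).le

theorem len_bypass_le [DecidableEq X] {ω : X → ℝ} (hω : ∀ y, 0 < ω y) (p : K.graph.Walk a b) :
    K.len ω p.bypass ≤ K.len ω p := by
  refine List.Sublist.sum_le_sum ((p.darts_bypass_sublist_darts.map _).map _) fun r hr => ?_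
  obtain ⟨y, -, rfl⟩ := List.mem_map.1 hr
  exact (hω y).le

theorem dim_of_mem_edgeList {p : K.graph.Walk a b} {y : X} (hy : y ∈ K.edgeList p) :
    K.dim y = 1 := by
  obtain ⟨d, -, rfl⟩ := List.mem_map.1 hy
  exact K.dim_edge d.adj

theorem mem_support_of_mem_edgeList {p : K.graph.Walk a b} {y v : X} (hy : y ∈ K.edgeList p)
    (hv : K.inc v y ≠ 0) : v ∈ p.support := by
  obtain ⟨d, hd, rfl⟩ := List.mem_map.1 hy
  rcases (K.inc_edge_iff d.adj v).1 hv with rfl | rfl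
  · exact p.dart_fst_mem_support_of_mem_darts hd
  · exact p.dart_snd_mem_support_of_mem_darts hd

theorem edge_notMem_edgeList {h : K.graph.Adj a b} {p : K.graph.Walk b c}
    (hp : (SimpleGraph.Walk.cons h p).IsPath) : K.edge h ∉ K.edgeList p := fun hm =>
  ((SimpleGraph.Walk.cons_isPath_iff _ _).1 hp).2
    (K.mem_support_of_mem_edgeList hm (K.inc_left_edge h))

theorem edgeList_nodup {p : K.graph.Walk a b} (hp : p.IsPath) : (K.edgeList p).Nodup := by
  induction p with
  | nil => simp
  | cons h p ih =>
    rw [edgeList_cons, List.nodup_cons]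
    exact ⟨K.edge_notMem_edgeList hp, ih hp.of_cons⟩

theorem chain_eq_zero {p : K.graph.Walk a b} {y : X} (hy : y ∉ K.edgeList p) :
    K.chain p y = 0 := by
  classical
  induction p with
  | nil => simp
  | cons h p ih =>
    rw [edgeList_cons, List.mem_cons, not_or] at hy
    rw [chain_cons, Pi.add_apply, ih hy.2, Pi.single_eq_of_ne hy.1, add_zero]

theorem chain_of_mem {p : K.graph.Walk a b} (hp : p.IsPath) {y : X} (hy : y ∈ K.edgeList p) :
    K.chain p y = 1 ∨ K.chain p y = -1 := by
  classical
  induction p with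
  | nil => simp at hy
  | cons h p ih =>
    rw [chain_cons, Pi.add_apply]
    by_cases hye : y = K.edge h
    · subst hye
      rw [K.chain_eq_zero (K.edge_notMem_edgeList hp), Pi.single_eq_same, add_zero]
      exact K.inc_cases (K.inc_right_edge h)
    · rw [Pi.single_eq_of_ne hye, zero_add]
      exact ih hp.of_cons ((List.mem_cons.1 hy).resolve_left hye)

-- The boundary of the chain telescopes along the walk to its end minus its start.
open Classical in
theorem sum_inc_mul_chain (p : K.graph.Walk a b) (v : X) :
    ∑ y, K.inc v y * K.chain p y = (if v = b then 1 else 0) - (if v = a then 1 else 0) := by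
  induction p with
  | nil => simp
  | @cons a b c h p ih =>
    simp only [chain_cons, Pi.add_apply, mul_add, Finset.sum_add_distrib, ih]
    have h1 : ∑ y, K.inc v y * (Pi.single (K.edge h) (K.inc b (K.edge h)) : X → ℝ) y
        = K.inc v (K.edge h) * K.inc b (K.edge h) := by
      simp [Pi.single_apply]
    have hsq : K.inc b (K.edge h) * K.inc b (K.edge h) = 1 := by
      rcases K.inc_cases (K.inc_right_edge h) with h | h <;> rw [h] <;> norm_num
    have h2 : K.inc v (K.edge h) * K.inc b (K.edge h)
        = (if v = b then 1 else 0) - (if v = a then 1 else 0) := by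
      by_cases hvb : v = b
      · subst hvb
        rw [hsq, if_pos rfl, if_neg h.1.symm, sub_zero]
      · by_cases hva : v = a
        · subst hva
          rw [K.inc_eq_neg_of_edge (K.dim_edge h) h.1 (K.inc_left_edge h) (K.inc_right_edge h),
            neg_mul, hsq, if_pos rfl, if_neg hvb, zero_sub]
        · have : K.inc v (K.edge h) = 0 := by
            by_contra hne
            rcases (K.inc_edge_iff h v).1 hne with h | h <;> contradiction
          rw [this, if_neg hva, if_neg hvb, zero_mul, sub_zero]
    rw [h1, h2]
    ring

-- A degree count: a path has two edges at each of its vertices, less one for each endpoint. The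
-- count is taken in `ℤ` so that the trivial path, with `2 - 1 - 1 = 0`, needs no exception.
open Classical in
theorem card_edges_at {p : K.graph.Walk a b} (hp : p.IsPath) (v : X) :
    (((Finset.univ.filter fun y => K.inc v y ≠ 0 ∧ y ∈ K.edgeList p).card : ℕ) : ℤ)
      = (if v ∈ p.support then 2 else 0) - (if v = a then 1 else 0) - (if v = b then 1 else 0) := by
  induction p with
  | @nil u =>
    by_cases h : v = u <;> simp [h]
  | @cons a b c h p ih =>
    have ha := ((SimpleGraph.Walk.cons_isPath_iff _ _).1 hp).2
    have hb := p.start_mem_support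
    have hc := p.end_mem_support
    have he := K.edge_notMem_edgeList hp
    specialize ih hp.of_cons
    simp only [SimpleGraph.Walk.support_cons, List.mem_cons, edgeList_cons]
    by_cases hv : K.inc v (K.edge h) ≠ 0
    · have e1 : (Finset.univ.filter fun y => K.inc v y ≠ 0 ∧ (y = K.edge h ∨ y ∈ K.edgeList p))
          = insert (K.edge h)
            (Finset.univ.filter fun y => K.inc v y ≠ 0 ∧ y ∈ K.edgeList p) := by
        ext y; simp only [Finset.mem_filter, Finset.mem_univ, true_and, Finset.mem_insert]
        grind
      rw [e1, Finset.card_insert_of_notMem (by simp [he])]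
      push_cast
      rw [ih]
      have hab := h.1
      rcases (K.inc_edge_iff h v).1 hv with rfl | rfl
      · grind
      · grind
    · have e1 : (Finset.univ.filter fun y => K.inc v y ≠ 0 ∧ (y = K.edge h ∨ y ∈ K.edgeList p))
          = (Finset.univ.filter fun y => K.inc v y ≠ 0 ∧ y ∈ K.edgeList p) := by
        ext y; simp only [Finset.mem_filter, Finset.mem_univ, true_and]
        grind
      rw [e1, ih]
      rw [K.inc_edge_iff, not_or] at hv
      simp [hv.1, hv.2]

/-- The relation is left arbitrary so that it can later be incidence among proper faces of an
attached 2-cell. -/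
theorem reflTransGen_of_walk {R : X → X → Prop} (p : K.graph.Walk a b)
    (hR : ∀ v y, y ∈ K.edgeList p → K.inc v y ≠ 0 → R v y ∧ R y v) :
    ∀ y ∈ K.edgeList p, Relation.ReflTransGen R a y ∧ Relation.ReflTransGen R y a := by
  induction p with
  | nil => simp
  | @cons a b c h p ih =>
    intro y hy
    rw [edgeList_cons] at hR hy
    have h1 := hR a _ List.mem_cons_self (K.inc_left_edge h)
    have h2 := hR b _ List.mem_cons_self (K.inc_right_edge h)
    rcases List.mem_cons.1 hy with rfl | hy
    · exact ⟨.single h1.1, .single h1.2⟩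
    · obtain ⟨h3, h4⟩ := ih (fun v y hy => hR v y (List.mem_cons_of_mem _ hy)) y hy
      exact ⟨.head h1.1 (.head h2.2 h3), (h4.tail h2.1).tail h1.2⟩

theorem edgePath_of_walk (p : K.graph.Walk a b) (hb : K.dim b = 0) :
    K.EdgePath a b (K.edgeList p) := by
  induction p with
  | nil => exact .nil _ hb
  | cons h p ih =>
    exact .cons _ _ _ _ _ (K.dim_edge h) (K.inc_left_edge h) (K.inc_right_edge h) h.1 (ih hb)

theorem NonDegenerate.le_len {K : CellComplex X} {ω : X → ℝ} (h : K.NonDegenerate ω) {x : X}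
    (hx : K.dim x = 1) (ha : K.inc a x ≠ 0) (hb : K.inc b x ≠ 0) (hab : a ≠ b)
    (p : K.graph.Walk a b) : ω x ≤ K.len ω p := by
  by_cases hp : K.edgeList p = [x]
  · simp [len, hp]
  · have hd : K.dim b = 0 := by have := K.dim_eq _ _ hb; omega
    exact (h x a b hx ha hb hab _ (K.edgePath_of_walk p hd) hp).le

theorem NonDegenerate.edge_le_len {K : CellComplex X} {ω : X → ℝ} (h : K.NonDegenerate ω)
    (hab : K.graph.Adj a b) (p : K.graph.Walk a b) : ω (K.edge hab) ≤ K.len ω p :=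
  h.le_len (K.dim_edge hab) (K.inc_left_edge hab) (K.inc_right_edge hab) hab.1 p

end walk

/-! ### Simple cycles through an edge -/

/-- The function `s` is the signed sum of the edges of a simple cycle of the 1-skeleton that
traverses `x` in the positive direction. -/
structure IsCircuit (K : CellComplex X) (x : X) (s : X → ℝ) : Prop where
  mem : ∀ y, s y = -1 ∨ s y = 0 ∨ s y = 1
  dim_eq : ∀ y, s y ≠ 0 → K.dim y = 1
  self_eq : s x = 1
  sum_inc_mul : ∀ v, ∑ y, K.inc v y * s y = 0
  ncard_eq : ∀ v, (∃ y, K.inc v y ≠ 0 ∧ s y ≠ 0) → Set.ncard {y | K.inc v y ≠ 0 ∧ s y ≠ 0} = 2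
  connected : ∀ R : X → X → Prop, (∀ v y, s y ≠ 0 → K.inc v y ≠ 0 → R v y ∧ R y v) →
    ∀ y y', s y ≠ 0 → s y' ≠ 0 → Relation.ReflTransGen R y y'

open Classical in
theorem single_add_chain_ne_zero_iff (K : CellComplex X) {a b x y : X} {p : K.graph.Walk b a}
    (hp : p.IsPath) (hxp : x ∉ K.edgeList p) :
    ((Pi.single x 1 : X → ℝ) + K.chain p) y ≠ 0 ↔ y = x ∨ y ∈ K.edgeList p := by
  rw [Pi.add_apply]
  by_cases hyx : y = x
  · subst hyx
    simp [K.chain_eq_zero hxp]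
  · rw [Pi.single_eq_of_ne hyx, zero_add, or_iff_right hyx]
    refine ⟨fun h => by_contra fun hy => h (K.chain_eq_zero hy), fun h => ?_⟩
    rcases K.chain_of_mem hp h with h | h <;> rw [h] <;> norm_num

-- The edge `x`, from `a` to `b`, closes up the path from `b` back to `a`. Boundaries cancel, and at
-- `a` and `b` the edge `x` supplies the second incident edge missing from the path.
open Classical in
theorem isCircuit_single_add_chain (K : CellComplex X) {a b x : X} (hx : K.dim x = 1)
    (ha : K.inc a x = -1) (hb : K.inc b x = 1) {p : K.graph.Walk b a} (hp : p.IsPath)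
    (hxp : x ∉ K.edgeList p) : K.IsCircuit x (Pi.single x 1 + K.chain p) := by
  have hs := fun y => K.single_add_chain_ne_zero_iff (y := y) hp hxp
  have hab : a ≠ b := by rintro rfl; rw [ha] at hb; norm_num at hb
  have hf : ∀ v, K.inc v x ≠ 0 ↔ v = a ∨ v = b := by
    intro v
    obtain ⟨c, d, -, -, -, -, -, h⟩ := K.edge_facets hx
    have h1 := (h a).1 (by rw [ha]; norm_num)
    have h2 := (h b).1 (by rw [hb]; norm_num)
    rw [h]
    grind
  refine ⟨fun y => ?_, fun y hy => ?_, ?_, fun v => ?_, fun v hv => ?_, fun R hR y y' hy hy' => ?_⟩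
  · rw [Pi.add_apply]
    by_cases hyx : y = x
    · subst hyx
      simp [K.chain_eq_zero hxp]
    · rw [Pi.single_eq_of_ne hyx, zero_add]
      by_cases hy : y ∈ K.edgeList p
      · rcases K.chain_of_mem hp hy with h | h <;> simp [h]
      · simp [K.chain_eq_zero hy]
  · rcases (hs y).1 hy with rfl | hy
    · exact hx
    · exact K.dim_of_mem_edgeList hy
  · simp [K.chain_eq_zero hxp]
  · simp only [Pi.add_apply, mul_add, Finset.sum_add_distrib, sum_inc_mul_chain]
    have h1 : ∑ y, K.inc v y * (Pi.single x 1 : X → ℝ) y = K.inc v x := by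
      simp [Pi.single_apply]
    rw [h1]
    by_cases hva : v = a
    · subst hva
      rw [ha, if_pos rfl, if_neg hab]; norm_num
    · by_cases hvb : v = b
      · subst hvb
        rw [hb, if_pos rfl, if_neg hva]; norm_num
      · have : K.inc v x = 0 := by
          by_contra h
          rcases (hf v).1 h with h | h <;> contradiction
        rw [this, if_neg hva, if_neg hvb]; norm_num
  · simp only [hs] at hv ⊢
    have hD := K.card_edges_at hp v
    have hset : {y | K.inc v y ≠ 0 ∧ (y = x ∨ y ∈ K.edgeList p)}
        = ((Finset.univ.filter fun y => K.inc v y ≠ 0 ∧ (y = x ∨ y ∈ K.edgeList p) : Finset X) :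
          Set X) := by
      ext; simp
    rw [hset, Set.ncard_coe_finset]
    have hvp : v ∈ p.support := by
      obtain ⟨y, hvy, rfl | hy⟩ := hv
      · rcases (hf v).1 hvy with rfl | rfl
        · exact p.end_mem_support
        · exact p.start_mem_support
      · exact K.mem_support_of_mem_edgeList hy hvy
    rw [if_pos hvp] at hD
    by_cases hvx : K.inc v x ≠ 0
    · have e1 : (Finset.univ.filter fun y => K.inc v y ≠ 0 ∧ (y = x ∨ y ∈ K.edgeList p))
          = insert x (Finset.univ.filter fun y => K.inc v y ≠ 0 ∧ y ∈ K.edgeList p) := by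
        ext y; simp only [Finset.mem_filter, Finset.mem_univ, true_and, Finset.mem_insert]
        grind
      rw [e1, Finset.card_insert_of_notMem (by simp [hxp])]
      rcases (hf v).1 hvx with rfl | rfl
      · rw [if_pos rfl, if_neg hab] at hD; omega
      · rw [if_pos rfl, if_neg hab.symm] at hD; omega
    · have e1 : (Finset.univ.filter fun y => K.inc v y ≠ 0 ∧ (y = x ∨ y ∈ K.edgeList p))
          = (Finset.univ.filter fun y => K.inc v y ≠ 0 ∧ y ∈ K.edgeList p) := by
        ext y; simp only [Finset.mem_filter, Finset.mem_univ, true_and]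
        grind
      rw [e1]
      rw [hf, not_or] at hvx
      rw [if_neg hvx.1, if_neg hvx.2] at hD
      omega
  · have hb0 : K.inc b x ≠ 0 := by rw [hb]; norm_num
    have key : ∀ y, ((Pi.single x 1 : X → ℝ) + K.chain p) y ≠ 0 →
        Relation.ReflTransGen R b y ∧ Relation.ReflTransGen R y b := by
      intro y hy
      rcases (hs y).1 hy with rfl | h
      · have := hR b y hy hb0
        exact ⟨.single this.1, .single this.2⟩
      · exact K.reflTransGen_of_walk p (fun v y h => hR v y ((hs y).2 (Or.inr h))) y h
    exact (key y hy).2.trans (key y' hy').1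

/-! ### Lipschitz potentials -/

theorem edge_symm (K : CellComplex X) {a b : X} (h : K.graph.Adj a b) :
    K.edge h.symm = K.edge h :=
  K.edge_eq h.symm (K.inc_right_edge h) (K.inc_left_edge h)

theorem len_reverse (K : CellComplex X) (ω : X → ℝ) {a b : X} (p : K.graph.Walk a b) :
    K.len ω p.reverse = K.len ω p := by
  induction p with
  | nil => simp
  | cons h p ih =>
    rw [SimpleGraph.Walk.reverse_cons, len_append, ih, len_cons, len_cons, len_nil, add_zero,
      K.edge_symm h, add_comm]

theorem coboundary_edge (K : CellComplex X) (f : X → ℝ) {a b : X} (h : K.graph.Adj a b) :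
    K.coboundary f (K.edge h) = K.inc a (K.edge h) * (f a - f b) := by
  classical
  rw [coboundary_apply, ← Finset.sum_subset (Finset.subset_univ {a, b}), Finset.sum_pair h.1,
    K.inc_eq_neg_of_edge (K.dim_edge h) h.1 (K.inc_left_edge h) (K.inc_right_edge h)]
  · ring
  · intro v _ hv
    by_contra hne
    exact hv (by simpa using (K.inc_edge_iff h v).1 (right_ne_zero_of_mul hne))

theorem exists_adj_of_inc_ne_zero (K : CellComplex X) {a y : X} (hy : K.dim y = 1)
    (ha : K.inc a y ≠ 0) : ∃ b, ∃ h : K.graph.Adj a b, K.edge h = y := by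
  obtain ⟨c, d, -, -, hcd, hc, hd, hf⟩ := K.edge_facets hy
  have hc' : K.inc c y ≠ 0 := by rw [hc]; norm_num
  have hd' : K.inc d y ≠ 0 := by rw [hd]; norm_num
  rcases (hf a).1 ha with rfl | rfl
  · exact ⟨d, ⟨hcd, y, hy, hc', hd'⟩, K.edge_eq _ hc' hd'⟩
  · exact ⟨c, ⟨hcd.symm, y, hy, hd', hc'⟩, K.edge_eq _ hd' hc'⟩

/-- The McShane extension of finitely many prescribed lower bounds to a function that is Lipschitz
for the path metric. -/
theorem exists_lipschitz_extension (K : CellComplex X) {ω : X → ℝ} (hω : ∀ y, 0 < ω y)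
    (T : Set (X × ℝ)) (B : ℝ) (hT : ∀ q ∈ T, q.2 ≤ B) :
    ∃ f : X → ℝ, (∀ a b (h : K.graph.Adj a b), |f a - f b| ≤ ω (K.edge h)) ∧
      (∀ q ∈ T, q.2 ≤ f q.1) ∧
      ∀ p c, (∃ q ∈ T, Nonempty (K.graph.Walk q.1 p)) →
        (∀ q ∈ T, ∀ w : K.graph.Walk q.1 p, q.2 - K.len ω w ≤ c) → f p ≤ c := by
  set S : X → Set ℝ := fun p => {r | ∃ q ∈ T, ∃ w : K.graph.Walk q.1 p, r = q.2 - K.len ω w}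
    with hS
  have hbdd : ∀ p, BddAbove (S p) := by
    rintro p
    refine ⟨B, ?_⟩
    rintro r ⟨q, hq, w, rfl⟩
    linarith [hT q hq, K.len_nonneg hω w]
  have hstep : ∀ a b (h : K.graph.Adj a b), ∀ r ∈ S a, r - ω (K.edge h) ∈ S b := by
    rintro a b h r ⟨q, hq, w, rfl⟩
    exact ⟨q, hq, w.concat h, by rw [len_concat]; ring⟩
  have hle : ∀ a b (h : K.graph.Adj a b), sSup (S a) - sSup (S b) ≤ ω (K.edge h) := by
    intro a b h
    -- On a component not reached from `T` both suprema are `sSup ∅ = 0`, so the potential is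
    -- constant there.
    rcases (S a).eq_empty_or_nonempty with he | hne
    · have hb : S b = ∅ := by
        by_contra hb
        obtain ⟨r, hr⟩ := Set.nonempty_iff_ne_empty.2 hb
        have := hstep b a h.symm r hr
        rw [he] at this
        exact this
      rw [he, hb, sub_self]
      exact (hω _).le
    · have : sSup (S a) ≤ sSup (S b) + ω (K.edge h) :=
        csSup_le hne fun r hr => by linarith [le_csSup (hbdd b) (hstep a b h r hr)]
      linarith
  refine ⟨fun p => sSup (S p), fun a b h => abs_le.2 ⟨?_, hle a b h⟩, fun q hq => ?_,
    fun p c hp hc => ?_⟩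
  · have := hle b a h.symm
    rw [K.edge_symm h] at this
    linarith
  · exact le_csSup (hbdd _) ⟨q, hq, .nil, by simp⟩
  · obtain ⟨q, hq, ⟨w⟩⟩ := hp
    refine csSup_le ⟨_, q, hq, w, rfl⟩ ?_
    rintro r ⟨q, hq, w, rfl⟩
    exact hc q hq w

/-! ### Prescribed values around `x` and their compatibility -/

section potential

variable {K : CellComplex X} {ω : X → ℝ} {x a b : X} {g : X → ℝ}

/-- The prescribed values at the neighbours of the endpoints `a` and `b` of `x` are compatible along
every path that avoids `a` and `b`. -/
def PathCompatible (K : CellComplex X) (ω : X → ℝ) (x a b : X) (g : X → ℝ) : Prop :=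
  ∀ w u (hw : K.graph.Adj b w) (hu : K.graph.Adj u a) (p : K.graph.Walk w u),
    p.IsPath → a ∉ p.support → b ∉ p.support →
    ω x - K.inc b (K.edge hw) * g (K.edge hw) - K.len ω p ≤
      -(K.inc a (K.edge hu) * g (K.edge hu))

theorem abs_inc_mul_le (hg : ∀ y, |g y| ≤ ω y) (v y : X) (hv : K.inc v y ≠ 0) :
    |K.inc v y * g y| ≤ ω y := by
  rcases K.inc_cases hv with h | h <;> rw [h] <;> simpa using hg y

/-- After shortening to a path, let `b`–`w` be its first edge. Since `|g| ≤ ω`, the value prescribed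
at `w` is at least `ω x` minus the length of that edge, so compatibility from `w` implies the bound
from `b`. -/
theorem PathCompatible.of_start (hK : PathCompatible K ω x a b g) (hω : ∀ y, 0 < ω y)
    (hg : ∀ y, |g y| ≤ ω y) {u : X} (hu : K.graph.Adj u a) (hub : u ≠ b) (p : K.graph.Walk b u)
    (hap : a ∉ p.support) : ω x - K.len ω p ≤ -(K.inc a (K.edge hu) * g (K.edge hu)) := by
  classical
  have hl := K.len_bypass_le hω p
  have hP := p.bypass_isPath
  have ha : a ∉ p.bypass.support := fun h => hap (p.support_bypass_subset_support h)
  generalize p.bypass = p' at hl hP ha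
  cases p' with
  | nil => exact absurd rfl hub
  | cons h q =>
    rw [SimpleGraph.Walk.support_cons, List.mem_cons, not_or] at ha
    have h1 := hK _ _ h hu q hP.of_cons ha.2 ((SimpleGraph.Walk.cons_isPath_iff _ _).1 hP).2
    have h2 := abs_le.1 (abs_inc_mul_le hg b _ (K.inc_left_edge h))
    rw [len_cons] at hl
    linarith [h2.2]

/-- The value prescribed at `w` exceeds `ω x` by at most the length of the edge `b`–`w`, and by
non-degeneracy no way back to `b` is shorter than this edge. -/
theorem sub_len_le_of_neighbor (hω : K.NonDegenerate ω) (hg : ∀ y, |g y| ≤ ω y) {w : X}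
    (hw : K.graph.Adj b w) (p : K.graph.Walk w b) :
    ω x - K.inc b (K.edge hw) * g (K.edge hw) - K.len ω p ≤ ω x := by
  have h1 := hω.edge_le_len hw.symm p
  have h2 := abs_le.1 (abs_inc_mul_le hg b _ (K.inc_left_edge hw))
  rw [K.edge_symm hw] at h1
  linarith [h2.1]

/-- If the walk meets `b`, the bound carried by its first portion has dropped to at most `ω x`
there, so the remainder is a walk covered by `PathCompatible.of_start`. -/
theorem PathCompatible.of_neighbor (hK : PathCompatible K ω x a b g) (hω : ∀ y, 0 < ω y)
    (hn : K.NonDegenerate ω) (hg : ∀ y, |g y| ≤ ω y) {w u : X} (hw : K.graph.Adj b w)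
    (hu : K.graph.Adj u a) (hub : u ≠ b) (p : K.graph.Walk w u) (hap : a ∉ p.support) :
    ω x - K.inc b (K.edge hw) * g (K.edge hw) - K.len ω p ≤
      -(K.inc a (K.edge hu) * g (K.edge hu)) := by
  classical
  by_cases hb : b ∈ p.support
  · have h1 := sub_len_le_of_neighbor (x := x) hn hg hw (p.takeUntil b hb)
    have h2 := hK.of_start hω hg hu hub (p.dropUntil b hb)
      fun h => hap (p.support_dropUntil_subset_support hb h)
    have h3 : K.len ω p = K.len ω (p.takeUntil b hb) + K.len ω (p.dropUntil b hb) := by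
      rw [← len_append, p.take_spec hb]
    linarith
  · have h1 := hK w u hw hu p.bypass p.bypass_isPath
      (fun h => hap (p.support_bypass_subset_support h))
      (fun h => hb (p.support_bypass_subset_support h))
    linarith [K.len_bypass_le hω p]

/-- Look at the last step `u`–`a` of a shortened walk. If `u = b` this step is `x` itself and costs
`ω x`; otherwise the value prescribed at `u` is at most the length of the step. -/
theorem PathCompatible.to_end (hK : PathCompatible K ω x a b g) (hω : ∀ y, 0 < ω y)
    (hn : K.NonDegenerate ω) (hg : ∀ y, |g y| ≤ ω y) (ha : K.inc a x ≠ 0) (hb : K.inc b x ≠ 0)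
    {w : X} (hw : K.graph.Adj b w) (hwa : w ≠ a) (p : K.graph.Walk w a) :
    ω x - K.inc b (K.edge hw) * g (K.edge hw) - K.len ω p ≤ 0 := by
  classical
  have hl := K.len_bypass_le hω p.reverse
  have hP := p.reverse.bypass_isPath
  rw [len_reverse] at hl
  generalize p.reverse.bypass = p' at hl hP
  cases p' with
  | nil => exact absurd rfl hwa
  | @cons _ u _ h q =>
    have haq := ((SimpleGraph.Walk.cons_isPath_iff _ _).1 hP).2
    rw [len_cons] at hl
    by_cases hub : u = b
    · subst hub
      have h1 := sub_len_le_of_neighbor (x := x) hn hg hw q.reverse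
      rw [len_reverse] at h1
      rw [K.edge_eq h ha hb] at hl
      linarith
    · have h1 := hK.of_neighbor hω hn hg hw h.symm hub q.reverse
        (by rwa [SimpleGraph.Walk.support_reverse, List.mem_reverse])
      have h2 := abs_le.1 (abs_inc_mul_le hg a _ (K.inc_right_edge h.symm))
      rw [len_reverse] at h1
      rw [K.edge_symm h] at h1 h2
      linarith [h2.1]

/-- The values at `a`, `b` and the neighbours of `b` enter as lower bounds of a McShane extension.
This is the least Lipschitz choice on the components reached, so the upper bounds at `a`, `b` and
the neighbours of `a` reduce to the walk inequalities above. -/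
theorem PathCompatible.exists_potential (hK : PathCompatible K ω x a b g) (hω : ∀ y, 0 < ω y)
    (hn : K.NonDegenerate ω) (hg : ∀ y, |g y| ≤ ω y) (hx : K.dim x = 1) (hab : a ≠ b)
    (ha : K.inc a x ≠ 0) (hb : K.inc b x ≠ 0) :
    ∃ f : X → ℝ, (∀ c d (h : K.graph.Adj c d), |f c - f d| ≤ ω (K.edge h)) ∧
      f a = 0 ∧ f b = ω x ∧
      (∀ w (hw : K.graph.Adj b w), w ≠ a →
        ω x - K.inc b (K.edge hw) * g (K.edge hw) ≤ f w) ∧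
      (∀ u (hu : K.graph.Adj u a), u ≠ b →
        f u ≤ -(K.inc a (K.edge hu) * g (K.edge hu))) := by
  set T : Set (X × ℝ) := {(a, 0), (b, ω x)} ∪
    {q | ∃ hw : K.graph.Adj b q.1, q.1 ≠ a ∧
      q.2 = ω x - K.inc b (K.edge hw) * g (K.edge hw)} with hT
  have haT : (a, 0) ∈ T := Or.inl (Or.inl rfl)
  have hbT : (b, ω x) ∈ T := Or.inl (Or.inr rfl)
  have hcases : ∀ P : X → ℝ → Prop, P a 0 → P b (ω x) →
      (∀ w (hw : K.graph.Adj b w), w ≠ a →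
        P w (ω x - K.inc b (K.edge hw) * g (K.edge hw))) → ∀ q ∈ T, P q.1 q.2 := by
    rintro P h1 h2 h3 ⟨q, t⟩ ((h | h) | ⟨hw, hwa, h⟩)
    · cases h; exact h1
    · cases h; exact h2
    · exact (congrArg (P q) h).mpr (h3 _ hw hwa)
  obtain ⟨B, hB⟩ : ∃ B, ∀ y, ω y ≤ B :=
    ⟨∑ y, ω y, fun y => Finset.single_le_sum (fun y _ => (hω y).le) (Finset.mem_univ y)⟩
  have hB0 : 0 ≤ B := (hω x).le.trans (hB x)
  obtain ⟨f, hf1, hf2, hf3⟩ := K.exists_lipschitz_extension hω T (B + B)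
    (hcases (fun _ t => t ≤ B + B) (by linarith) (by linarith [hB x]) fun w hw _ => by
      have h2 := abs_le.1 (abs_inc_mul_le hg b _ (K.inc_left_edge hw))
      linarith [h2.1, hB x, hB (K.edge hw)])
  have toa : ∀ q ∈ T, ∀ p : K.graph.Walk q.1 a, q.2 - K.len ω p ≤ 0 := by
    refine hcases (fun q t => ∀ p : K.graph.Walk q a, t - K.len ω p ≤ 0) ?_ ?_ ?_
    · intro p; linarith [K.len_nonneg hω p]
    · intro p; linarith [hn.le_len hx hb ha hab.symm p]
    · intro w hw hwa p
      exact hK.to_end hω hn hg ha hb hw hwa p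
  refine ⟨f, hf1, le_antisymm ?_ (hf2 _ haT), le_antisymm ?_ (hf2 _ hbT),
    fun w hw hwa => hf2 (w, _) (Or.inr ⟨hw, hwa, rfl⟩), fun u hu hub => ?_⟩
  · exact hf3 a 0 ⟨_, haT, ⟨.nil⟩⟩ toa
  · refine hf3 b (ω x) ⟨_, hbT, ⟨.nil⟩⟩
      (hcases (fun q t => ∀ p : K.graph.Walk q b, t - K.len ω p ≤ ω x) ?_ ?_ ?_)
    · intro p; linarith [K.len_nonneg hω p, hω x]
    · intro p; linarith [K.len_nonneg hω p]
    · intro w hw _ p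
      exact sub_len_le_of_neighbor hn hg hw p
  · refine hf3 u _ ⟨_, haT, ⟨.cons hu.symm .nil⟩⟩ fun q hq p => ?_
    classical
    -- A walk through `a` carries a bound at most `0` there, then loses at least the length of the
    -- edge `a`–`u`; a walk avoiding `a` is handled by compatibility.
    by_cases hap : a ∈ p.support
    · have h1 := toa q hq (p.takeUntil a hap)
      have h2 := hn.edge_le_len hu.symm (p.dropUntil a hap)
      have h3 : K.len ω p = K.len ω (p.takeUntil a hap) + K.len ω (p.dropUntil a hap) := by
        rw [← len_append, p.take_spec hap]
      have h4 := abs_le.1 (abs_inc_mul_le hg a _ (K.inc_right_edge hu))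
      rw [K.edge_symm hu] at h2
      linarith [h4.2]
    · revert p
      refine hcases (fun q t => ∀ p : K.graph.Walk q u, a ∉ p.support →
        t - K.len ω p ≤ -(K.inc a (K.edge hu) * g (K.edge hu))) ?_ ?_ ?_ q hq
      · intro p hap
        exact absurd p.start_mem_support hap
      · intro p hap
        exact hK.of_start hω hg hu hub p hap
      · intro w hw _ p hap
        exact hK.of_neighbor hω hn hg hw hu hub p hap

end potential

/-! ### Feasible potentials -/

theorem abs_coboundary_le (K : CellComplex X) {ω : X → ℝ} (hω : ∀ y, 0 < ω y) (hd : K.DimLE 1)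
    {f : X → ℝ} (hf : ∀ c d (h : K.graph.Adj c d), |f c - f d| ≤ ω (K.edge h)) (y : X) :
    |K.coboundary f y| ≤ ω y := by
  by_cases hy : K.dim y = 1
  · obtain ⟨c, d, -, -, hcd, hc, -, -⟩ := K.edge_facets hy
    obtain ⟨d, h, rfl⟩ := K.exists_adj_of_inc_ne_zero hy (a := c) (by rw [hc]; norm_num)
    rw [coboundary_edge, hc, neg_one_mul, abs_neg]
    exact hf _ _ h
  · have : K.coboundary f y = 0 := by
      rw [coboundary_apply]
      refine Finset.sum_eq_zero fun v _ => ?_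
      by_contra hne
      have := K.dim_eq _ _ (right_ne_zero_of_mul hne)
      have := hd y
      omega
    rw [this, abs_zero]
    exact (hω y).le

theorem lowerLap_edge (K : CellComplex X) {x a b : X} (hx : K.dim x = 1) (ha : K.inc a x = -1)
    (hb : K.inc b x = 1) (y : X) :
    K.lowerLap x y = K.m y / K.m b * K.inc b y - K.m y / K.m a * K.inc a y := by
  classical
  have hab : a ≠ b := by rintro rfl; rw [ha] at hb; norm_num at hb
  have h : K.graph.Adj a b := ⟨hab, x, hx, by rw [ha]; norm_num, by rw [hb]; norm_num⟩
  have he : K.edge h = x := K.edge_eq h (by rw [ha]; norm_num) (by rw [hb]; norm_num)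
  rw [lowerLap, ← Finset.sum_subset (Finset.subset_univ {a, b}), Finset.sum_pair hab, ha, hb]
  · ring
  · intro v _ hv
    by_contra hne
    refine hv ?_
    rw [← he] at hne
    simpa using (K.inc_edge_iff h v).1 (right_ne_zero_of_mul hne)

/-- Compatible prescribed values are improved by a feasible potential. -/
theorem PathCompatible.exists_feasible {K : CellComplex X} {ω : X → ℝ} {x a b : X} {g : X → ℝ}
    (hK : PathCompatible K ω x a b g) (hω : ∀ y, 0 < ω y) (hd : K.DimLE 1)
    (hn : K.NonDegenerate ω) (hg : ∀ y, |g y| ≤ ω y) (hgx : g x = ω x) (hx : K.dim x = 1)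
    (ha : K.inc a x = -1) (hb : K.inc b x = 1) :
    ∃ f : X → ℝ, K.coboundary f x = ω x ∧ (∀ y, |K.coboundary f y| ≤ ω y) ∧
      K.coboundary (K.coboundaryAdj (K.coboundary f)) x ≤ ∑ y, K.lowerLap x y * g y := by
  have hab : a ≠ b := by rintro rfl; rw [ha] at hb; norm_num at hb
  have ha0 : K.inc a x ≠ 0 := by rw [ha]; norm_num
  have hb0 : K.inc b x ≠ 0 := by rw [hb]; norm_num
  have h : K.graph.Adj b a := ⟨hab.symm, x, hx, hb0, ha0⟩
  have he : K.edge h = x := K.edge_eq h hb0 ha0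
  obtain ⟨f, hf, hfa, hfb, hfw, hfu⟩ := hK.exists_potential hω hn hg hx hab ha0 hb0
  have hfx : K.coboundary f x = ω x := by
    have := K.coboundary_edge f h
    rw [he] at this
    rw [this, hb, hfa, hfb, sub_zero, one_mul]
  refine ⟨f, hfx, K.abs_coboundary_le hω hd hf, ?_⟩
  rw [lowerLap_apply]
  refine Finset.sum_le_sum fun y _ => ?_
  by_cases hyx : y = x
  · rw [hyx, hfx, hgx]
  by_cases hy : K.dim y = 1
  swap
  · rw [lowerLap_eq_zero _ (by rw [hx]; exact hy), zero_mul, zero_mul]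
  have hm := fun v => div_pos (K.m_pos y) (K.m_pos v)
  rw [K.lowerLap_edge hx ha hb]
  -- An edge `a`–`u` contributes `m(y)/m(a) * f u`, and an edge `b`–`w` contributes `m(y)/m(b) * (ω
  -- x - f w)`. So an upper bound on `f u` and a lower bound on `f w` are what is needed.
  by_cases hby : K.inc b y = 0
  · by_cases hay : K.inc a y = 0
    · simp [hby, hay]
    · obtain ⟨u, hu, rfl⟩ := K.exists_adj_of_inc_ne_zero hy hay
      have hub : u ≠ b := by
        rintro rfl
        exact K.inc_right_edge hu hby
      have h1 := hfu u hu.symm hub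
      rw [K.edge_symm hu] at h1
      rw [coboundary_edge, hby, hfa]
      have hsq : K.inc a (K.edge hu) * K.inc a (K.edge hu) = 1 := by
        rcases K.inc_cases hay with h | h <;> rw [h] <;> norm_num
      have h2 := mul_le_mul_of_nonneg_left h1 (hm a).le
      calc _ = K.m (K.edge hu) / K.m a * f u * (K.inc a (K.edge hu) * K.inc a (K.edge hu)) := by
              ring
        _ ≤ _ := by rw [hsq, mul_one]; linarith
  · have hay : K.inc a y = 0 := by
      by_contra hay
      exact hyx (K.edge_eq_of_two_facets hx hab ha0 hb0 hay hby).symm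
    obtain ⟨w, hw, rfl⟩ := K.exists_adj_of_inc_ne_zero hy hby
    have hwa : w ≠ a := by
      rintro rfl
      exact K.inc_right_edge hw hay
    have h1 := hfw w hw hwa
    rw [coboundary_edge, hay, hfb]
    have hsq : K.inc b (K.edge hw) * K.inc b (K.edge hw) = 1 := by
      rcases K.inc_cases hby with h | h <;> rw [h] <;> norm_num
    have h2 := mul_le_mul_of_nonneg_left h1 (hm b).le
    calc _ = K.m (K.edge hw) / K.m b * (ω x - f w) *
            (K.inc b (K.edge hw) * K.inc b (K.edge hw)) := by ring
      _ ≤ _ := by rw [hsq, mul_one]; linarith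

/-- If every edge is a shortest path, there is a feasible potential. -/
theorem NonDegenerate.exists_feasible {K : CellComplex X} {ω : X → ℝ} (hn : K.NonDegenerate ω)
    (hω : ∀ y, 0 < ω y) (hd : K.DimLE 1) {x : X} (hx : K.dim x = 1) :
    ∃ f : X → ℝ, K.coboundary f x = ω x ∧ ∀ y, |K.coboundary f y| ≤ ω y := by
  obtain ⟨a, b, -, -, hab, ha, hb, -⟩ := K.edge_facets hx
  have ha0 : K.inc a x ≠ 0 := by rw [ha]; norm_num
  have hb0 : K.inc b x ≠ 0 := by rw [hb]; norm_num
  have h : K.graph.Adj b a := ⟨hab.symm, x, hx, hb0, ha0⟩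
  have he : K.edge h = x := K.edge_eq h hb0 ha0
  obtain ⟨f, hf1, hf2, hf3⟩ := K.exists_lipschitz_extension hω {(a, 0), (b, ω x)} (ω x) (by
    rintro q (rfl | rfl)
    · exact (hω x).le
    · exact le_rfl)
  refine ⟨f, ?_, K.abs_coboundary_le hω hd hf1⟩
  have h1 : f a = 0 := by
    refine le_antisymm (hf3 a 0 ⟨_, Or.inl rfl, ⟨.nil⟩⟩ ?_) (hf2 (a, 0) (Or.inl rfl))
    rintro q (rfl | rfl) p
    · linarith [K.len_nonneg hω p]
    · linarith [hn.le_len hx hb0 ha0 hab.symm p]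
  have h2 : f b = ω x := by
    refine le_antisymm ?_ (hf2 (b, ω x) (Or.inr rfl))
    have := (abs_le.1 (hf1 _ _ h)).2
    rw [he, h1] at this
    linarith
  have := K.coboundary_edge f h
  rw [he] at this
  rw [this, hb, h1, h2, sub_zero, one_mul]

/-! ### Shortcutting cycles -/

theorem lowerLap_mul_m (K : CellComplex X) (x y : X) :
    K.lowerLap y x * K.m y = K.lowerLap x y * K.m x := by
  rw [lowerLap, lowerLap, Finset.sum_mul, Finset.sum_mul]
  exact Finset.sum_congr rfl fun v _ => by ring

theorem lowerLap_symm_ne_zero (K : CellComplex X) {x y : X} (h : K.lowerLap x y ≠ 0) :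
    K.lowerLap y x ≠ 0 := fun h0 => by
  have := K.lowerLap_mul_m x y
  rw [h0, zero_mul] at this
  exact mul_ne_zero h (K.m_pos x).ne' this.symm

/-- At an endpoint of `x` the cycle has only one other edge, and the two boundary contributions
cancel. Hence the signs next to `x` depend only on the support, which matters because
`ShortCycle.sign` is a choice among the signings of an edge set. -/
theorem IsCircuit.inc_mul_eq {K : CellComplex X} {x : X} {s : X → ℝ} (hs : K.IsCircuit x s)
    {v y : X} (hvx : K.inc v x ≠ 0) (hvy : K.inc v y ≠ 0) (hy : s y ≠ 0) (hyx : y ≠ x) :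
    K.inc v y * s y = -K.inc v x := by
  classical
  have hx : s x ≠ 0 := by rw [hs.self_eq]; exact one_ne_zero
  have hS : {y | K.inc v y ≠ 0 ∧ s y ≠ 0} = {x, y} := by
    symm
    apply Set.eq_of_subset_of_ncard_le _ _ (Set.toFinite _)
    · rintro z (rfl | rfl)
      · exact ⟨hvx, hx⟩
      · exact ⟨hvy, hy⟩
    · rw [hs.ncard_eq v ⟨x, hvx, hx⟩, Set.ncard_pair hyx.symm]
  have hsum := hs.sum_inc_mul v
  rw [← Finset.sum_subset (Finset.subset_univ {x, y}), Finset.sum_pair hyx.symm, hs.self_eq]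
    at hsum
  · linarith
  · intro z _ hz
    by_contra hne
    have : z ∈ ({x, y} : Set X) := by
      rw [← hS]
      exact ⟨left_ne_zero_of_mul hne, right_ne_zero_of_mul hne⟩
    exact hz (by simpa using this)

open Classical in
/-- The cycle with signed edge sum `s` is shortcutting for `x`. -/
def IsShort (K : CellComplex X) (ω : X → ℝ) (x : X) (s : X → ℝ) : Prop :=
  ∑ y with s y ≠ 0, ω y < 2 * ∑ y with s y ≠ 0 ∧ K.lowerLap y x ≠ 0, ω y

/-- The edge sets of shortcutting cycles through `x`. -/
def ShortCycle (K : CellComplex X) (ω : X → ℝ) (x : X) : Type u :=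
  {S : Set X // ∃ s, K.IsCircuit x s ∧ K.IsShort ω x s ∧ {y | s y ≠ 0} = S}

/-- Indexing by edge sets rather than by signings gives finiteness, and ensures that attached cells
are determined by their facets. -/
noncomputable instance (K : CellComplex X) (ω : X → ℝ) (x : X) : Fintype (K.ShortCycle ω x) :=
  haveI : Finite (K.ShortCycle ω x) := Subtype.finite
  Fintype.ofFinite _

namespace ShortCycle

variable {K : CellComplex X} {ω : X → ℝ} {x : X}

/-- The signed edge sum of a shortcutting cycle. -/
noncomputable def sign (S : K.ShortCycle ω x) : X → ℝ := S.2.choose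

theorem isCircuit (S : K.ShortCycle ω x) : K.IsCircuit x S.sign := S.2.choose_spec.1

theorem isShort (S : K.ShortCycle ω x) : K.IsShort ω x S.sign := S.2.choose_spec.2.1

theorem support_sign (S : K.ShortCycle ω x) : {y | S.sign y ≠ 0} = S.1 := S.2.choose_spec.2.2

end ShortCycle

theorem sum_eq_list_sum {F : X → ℝ} {L : List X} (hL : L.Nodup) (hF : ∀ y, y ∉ L → F y = 0) :
    ∑ y, F y = (L.map F).sum := by
  classical
  rw [← List.sum_toFinset F hL]
  exact (Finset.sum_subset (Finset.subset_univ _) fun y _ hy => hF y (by simpa using hy)).symm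

theorem neg_list_sum_le {α : Type*} (F G : α → ℝ) (h : ∀ y, -G y ≤ F y) (L : List α) :
    -(L.map G).sum ≤ (L.map F).sum := by
  induction L with
  | nil => simp
  | cons y L ih =>
    simp only [List.map_cons, List.sum_cons]
    linarith [h y]

/-- Values that are nonpositive on all shortcutting cycles through `x` are compatible along paths. -/
theorem pathCompatible_of_shortCycle {K : CellComplex X} {ω : X → ℝ} (hω : ∀ y, 0 < ω y)
    {x a b : X} {g : X → ℝ} (hg : ∀ y, |g y| ≤ ω y) (hgx : g x = ω x) (hx : K.dim x = 1)
    (ha : K.inc a x = -1) (hb : K.inc b x = 1)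
    (hS : ∀ S : K.ShortCycle ω x, ∑ y, S.sign y * g y ≤ 0) :
    PathCompatible K ω x a b g := by
  classical
  intro w u hw hu p hp hap hbp
  have hab : a ≠ b := by rintro rfl; rw [ha] at hb; norm_num at hb
  have ha0 : K.inc a x ≠ 0 := by rw [ha]; norm_num
  have hb0 : K.inc b x ≠ 0 := by rw [hb]; norm_num
  have hwp := p.start_mem_support
  have hup := p.end_mem_support
  set y₁ := K.edge hw with hy₁
  set y₂ := K.edge hu with hy₂
  have hby₁ : K.inc b y₁ ≠ 0 := K.inc_left_edge hw
  have hay₂ : K.inc a y₂ ≠ 0 := K.inc_right_edge hu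
  have hay₁ : K.inc a y₁ = 0 := by
    by_contra h
    rcases (K.inc_edge_iff hw a).1 h with h | h
    · exact hab h
    · exact hap (h ▸ hwp)
  have hby₂ : K.inc b y₂ = 0 := by
    by_contra h
    rcases (K.inc_edge_iff hu b).1 h with h | h
    · exact hbp (h ▸ hup)
    · exact hab h.symm
  have hxy₁ : y₁ ≠ x := fun h => ha0 (h ▸ hay₁)
  have hxy₂ : y₂ ≠ x := fun h => hb0 (h ▸ hby₂)
  have hy₁₂ : y₁ ≠ y₂ := fun h => hby₁ (h ▸ hby₂)
  -- The path `p` avoids `a` and `b`, so `x`, `y₁`, the edges of `p` and `y₂` form a simple cycle.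
  set q : K.graph.Walk b a := .cons hw (p.concat hu) with hq
  have hqP : q.IsPath := by
    rw [hq, SimpleGraph.Walk.cons_isPath_iff]
    refine ⟨hp.concat hap hu, ?_⟩
    rw [SimpleGraph.Walk.support_concat]
    simp [hbp, hab.symm]
  have hqL : K.edgeList q = y₁ :: (K.edgeList p ++ [y₂]) := by
    rw [hq, edgeList_cons, edgeList_concat]
  have hxq : x ∉ K.edgeList q := by
    rw [hqL]
    intro h
    simp only [List.mem_cons, List.mem_append, List.not_mem_nil, or_false] at h
    rcases h with h | h | h
    · exact hxy₁ h.symm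
    · exact hap (K.mem_support_of_mem_edgeList h ha0)
    · exact hxy₂ h.symm
  have hnd : (x :: K.edgeList q).Nodup := List.nodup_cons.2 ⟨hxq, K.edgeList_nodup hqP⟩
  have hs0 := fun y => K.single_add_chain_ne_zero_iff (y := y) hqP hxq
  have hcirc := K.isCircuit_single_add_chain hx ha hb hqP hxq
  set s₀ : X → ℝ := Pi.single x 1 + K.chain q with hs₀
  have b₁ := abs_le.1 (abs_inc_mul_le (K := K) hg b y₁ hby₁)
  have b₂ := abs_le.1 (abs_inc_mul_le (K := K) hg a y₂ hay₂)
  by_cases hsh : K.IsShort ω x s₀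
  · let S : K.ShortCycle ω x := ⟨{y | s₀ y ≠ 0}, s₀, hcirc, hsh, rfl⟩
    have hsupp : ∀ y, S.sign y ≠ 0 ↔ y = x ∨ y ∈ K.edgeList q := fun y => by
      rw [← hs0]
      exact Set.ext_iff.1 S.support_sign y
    have h1 : K.inc b y₁ * S.sign y₁ = -1 := by
      rw [S.isCircuit.inc_mul_eq hb0 hby₁ ((hsupp _).2 (Or.inr (by simp [hqL]))) hxy₁, hb]
    have h2 : K.inc a y₂ * S.sign y₂ = 1 := by
      rw [S.isCircuit.inc_mul_eq ha0 hay₂ ((hsupp _).2 (Or.inr (by simp [hqL]))) hxy₂, ha]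
      norm_num
    have e1 : S.sign y₁ = -K.inc b y₁ := by
      rcases K.inc_cases hby₁ with h | h <;> rw [h] at h1 ⊢ <;> linarith
    have e2 : S.sign y₂ = K.inc a y₂ := by
      rcases K.inc_cases hay₂ with h | h <;> rw [h] at h2 ⊢ <;> linarith
    have h3 := hS S
    rw [sum_eq_list_sum hnd, hqL] at h3
    · simp only [List.map_cons, List.map_append, List.map_nil, List.sum_cons, List.sum_append,
        List.sum_nil, S.isCircuit.self_eq, e1, e2, hgx] at h3
      -- Along `p` the signed sum of `g` is at least `-K.len ω p`, so the cycle inequality becomes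
      -- the path inequality.
      have h4 := neg_list_sum_le (fun y => S.sign y * g y) ω (fun y => by
        have := abs_le.1 (hg y)
        rcases S.isCircuit.mem y with h | h | h <;> rw [h] <;> linarith [hω y]) (K.edgeList p)
      rw [len]
      linarith
    · intro y hy
      have : S.sign y = 0 := by
        by_contra h
        exact hy (List.mem_cons.2 ((hsupp y).1 h))
      rw [this, zero_mul]
  -- A non-shortcutting cycle imposes nothing new: `x`, `y₁`, `y₂` make up at most half of its
  -- length, so `p` is at least as long as the three together and `|g| ≤ ω` suffices.
  · rw [IsShort, not_lt] at hsh
    have e1 : (Finset.univ.filter fun y => s₀ y ≠ 0) = (x :: K.edgeList q).toFinset := by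
      ext y
      simp [hs0]
    have e2 : ({x, y₁, y₂} : Finset X) ⊆
        Finset.univ.filter fun y => s₀ y ≠ 0 ∧ K.lowerLap y x ≠ 0 := by
      intro y hy
      rw [Finset.mem_filter]
      simp only [Finset.mem_insert, Finset.mem_singleton] at hy
      have hm := fun v => (div_pos (K.m_pos y) (K.m_pos v))
      refine ⟨Finset.mem_univ _, (hs0 y).2 ?_, K.lowerLap_symm_ne_zero ?_⟩
      · rw [hqL]
        rcases hy with h | h | h <;> simp [h]
      · rw [K.lowerLap_edge hx ha hb]
        rcases hy with rfl | rfl | rfl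
        · rw [ha, hb]
          have := add_pos (hm b) (hm a)
          linarith
        · rw [hay₁, mul_zero, sub_zero]
          exact mul_ne_zero (hm b).ne' hby₁
        · rw [hby₂, mul_zero, zero_sub]
          exact neg_ne_zero.2 (mul_ne_zero (hm a).ne' hay₂)
    have e3 := Finset.sum_le_sum_of_subset_of_nonneg (f := ω) e2 fun y _ _ => (hω y).le
    rw [Finset.sum_insert (by simp [hxy₁.symm, hxy₂.symm]), Finset.sum_pair hy₁₂] at e3
    rw [e1, List.sum_toFinset _ hnd, hqL] at hsh
    simp only [List.map_cons, List.map_append, List.map_nil, List.sum_cons, List.sum_append,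
      List.sum_nil] at hsh
    rw [len]
    linarith [b₁.1, b₂.2]

/-! ### Linear programming duality -/

/-- Linear programming duality: the Ollivier curvature is attained by a nonnegative combination of
shortcutting cycles. -/
theorem exists_weights {K : CellComplex X} {ω : X → ℝ} (hω : ∀ y, 0 < ω y) (hd : K.DimLE 1)
    (hn : K.NonDegenerate ω) {x : X} (hx : K.dim x = 1) {V : ℝ}
    (hV : ∀ f : X → ℝ, K.coboundary f x = ω x → (∀ y, |K.coboundary f y| ≤ ω y) →
      V ≤ K.coboundary (K.coboundaryAdj (K.coboundary f)) x) :
    ∃ c : K.ShortCycle ω x → ℝ, (∀ S, 0 ≤ c S) ∧ ∀ g : X → ℝ, (∀ y, |g y| ≤ ω y) → g x = ω x →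
      V ≤ ∑ y, (K.lowerLap x y + ∑ S, c S * S.sign y) * g y := by
  classical
  obtain ⟨a, b, -, -, -, ha, hb, -⟩ := K.edge_facets hx
  have hωx := hω x
  have hprimal : ∀ g : X → ℝ, (∀ y, |g y| ≤ ω y) → g x = ω x →
      (∀ S : K.ShortCycle ω x, ∑ y, S.sign y * g y ≤ 0) → V ≤ ∑ y, K.lowerLap x y * g y := by
    intro g hg hgx hS
    obtain ⟨f, h1, h2, h3⟩ := (pathCompatible_of_shortCycle hω hg hgx hx ha hb hS).exists_feasible
      hω hd hn hg hgx hx ha hb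
    exact (hV f h1 h2).trans h3
  let pr : X → (X → ℝ) →ₗ[ℝ] ℝ := fun y => LinearMap.proj y
  -- The problem is homogenised by replacing the constant `1` with `g x / ω x`; the box becomes `±g
  -- y ≤ ω y / ω x * g x`.
  let A : K.ShortCycle ω x ⊕ (X ⊕ X) → (X → ℝ) →ₗ[ℝ] ℝ := Sum.elim
    (fun S => ∑ y, S.sign y • pr y)
    (Sum.elim (fun y => pr y - (ω y / ω x) • pr x) (fun y => -pr y - (ω y / ω x) • pr x))
  let B : (X → ℝ) →ₗ[ℝ] ℝ := (V / ω x) • pr x - ∑ y, K.lowerLap x y • pr y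
  have hA1 : ∀ S g, A (.inl S) g = ∑ y, S.sign y * g y := by
    intro S g; simp [A, pr]
  have hA2 : ∀ y g, A (.inr (.inl y)) g = g y - ω y / ω x * g x := by
    intro S g; simp [A, pr]
  have hA3 : ∀ y g, A (.inr (.inr y)) g = -g y - ω y / ω x * g x := by
    intro S g; simp [A, pr]
  have hB : ∀ g, B g = V / ω x * g x - ∑ y, K.lowerLap x y * g y := by
    intro g; simp [B, pr]
  obtain ⟨c, hc, hBc⟩ := exists_nonneg_combination_of_forall_nonpos Finset.univ A B (by
    intro g hg
    have h1 : ∀ S : K.ShortCycle ω x, ∑ y, S.sign y * g y ≤ 0 := fun S => by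
      rw [← hA1]; exact hg _ (Finset.mem_univ _)
    have h2 : ∀ y, g y ≤ ω y / ω x * g x := fun y => by
      have := hg (.inr (.inl y)) (Finset.mem_univ _)
      rw [hA2] at this; linarith
    have h3 : ∀ y, -g y ≤ ω y / ω x * g x := fun y => by
      have := hg (.inr (.inr y)) (Finset.mem_univ _)
      rw [hA3] at this; linarith
    have hgx : 0 ≤ g x := by
      have := h3 x
      rw [div_self hωx.ne'] at this
      linarith
    rw [hB]
    -- If `g x = 0` the homogenised box forces `g = 0`; otherwise rescale to `g x = ω x`.
    rcases hgx.eq_or_lt with h0 | h0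
    · have hg0 : ∀ y, g y = 0 := fun y => by
        have := h2 y
        have := h3 y
        rw [← h0, mul_zero] at *
        linarith
      simp [hg0]
    · set t := ω x / g x with ht
      have htp : 0 < t := div_pos hωx h0
      have htg : t * g x = ω x := by rw [ht]; field_simp
      have h4 := hprimal (fun y => t * g y) (fun y => by
          have e : ω y = t * (ω y / ω x * g x) := by
            rw [ht]; field_simp
          rw [abs_mul, abs_of_pos htp, e]
          exact mul_le_mul_of_nonneg_left (abs_le.2 ⟨by linarith [h3 y], h2 y⟩) htp.le)
        htg (fun S => by
          have : ∑ y, S.sign y * (t * g y) = t * ∑ y, S.sign y * g y := by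
            rw [Finset.mul_sum]
            exact Finset.sum_congr rfl fun y _ => by ring
          rw [this]
          exact mul_nonpos_of_nonneg_of_nonpos htp.le (h1 S))
      have e1 : ∑ y, K.lowerLap x y * (t * g y) = t * ∑ y, K.lowerLap x y * g y := by
        rw [Finset.mul_sum]
        exact Finset.sum_congr rfl fun y _ => by ring
      have e2 : V = t * (V / ω x * g x) := by
        rw [ht]; field_simp
      rw [e1, e2] at h4
      linarith [le_of_mul_le_mul_left h4 htp])
  refine ⟨fun S => c (.inl S), fun S => hc _, fun g hg hgx => ?_⟩
  have h1 : B g = ∑ i, c i * A i g := by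
    rw [hBc]
    simp
  rw [hB, Fintype.sum_sum_type, Fintype.sum_sum_type, hgx, div_mul_cancel₀ _ hωx.ne'] at h1
  -- On the box these constraints are nonpositive, so their multipliers can be discarded, leaving
  -- only those of the cycles.
  have h2 : ∑ y, c (.inr (.inl y)) * A (.inr (.inl y)) g ≤ 0 := by
    refine Finset.sum_nonpos fun y _ => mul_nonpos_of_nonneg_of_nonpos (hc _) ?_
    rw [hA2, hgx, div_mul_cancel₀ _ hωx.ne']
    linarith [(abs_le.1 (hg y)).2]
  have h3 : ∑ y, c (.inr (.inr y)) * A (.inr (.inr y)) g ≤ 0 := by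
    refine Finset.sum_nonpos fun y _ => mul_nonpos_of_nonneg_of_nonpos (hc _) ?_
    rw [hA3, hgx, div_mul_cancel₀ _ hωx.ne']
    linarith [(abs_le.1 (hg y)).1]
  have h4 : ∑ S, c (.inl S) * A (.inl S) g = ∑ y, (∑ S, c (.inl S) * S.sign y) * g y := by
    simp only [hA1, Finset.sum_mul, Finset.mul_sum]
    rw [Finset.sum_comm]
    exact Finset.sum_congr rfl fun y _ => Finset.sum_congr rfl fun S _ => by ring
  simp only [add_mul, Finset.sum_add_distrib]
  linarith

/-! ### Attaching 2-cells along cycles -/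

theorem IsCircuit.diamond_sign {G : CellComplex X} {x : X} {s : X → ℝ} (hs : G.IsCircuit x s)
    {v : X} (h : ∃ y, G.inc v y ≠ 0 ∧ s y ≠ 0) :
    (∃ y, G.inc v y * s y = 1) ∧ ∃ y, G.inc v y * s y = -1 := by
  classical
  obtain ⟨y, z, hyz, hS⟩ := Set.ncard_eq_two.1 (hs.ncard_eq v h)
  have hy : G.inc v y ≠ 0 ∧ s y ≠ 0 := by
    have : y ∈ {y | G.inc v y ≠ 0 ∧ s y ≠ 0} := by rw [hS]; exact Or.inl rfl
    exact this
  have hsum := hs.sum_inc_mul v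
  rw [← Finset.sum_subset (Finset.subset_univ {y, z}), Finset.sum_pair hyz] at hsum
  · have h1 : G.inc v y * s y = 1 ∨ G.inc v y * s y = -1 := by
      rcases G.inc_cases hy.1 with h1 | h1 <;> rcases hs.mem y with h2 | h2 | h2
      all_goals first
        | exact absurd h2 hy.2
        | rw [h1, h2]; norm_num
    rcases h1 with h1 | h1
    · exact ⟨⟨y, h1⟩, z, by linarith⟩
    · exact ⟨⟨z, by linarith⟩, y, h1⟩
  · intro u _ hu
    by_contra hne
    have : u ∈ ({y, z} : Set X) := by
      rw [← hS]
      exact ⟨left_ne_zero_of_mul hne, right_ne_zero_of_mul hne⟩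
    exact hu (by simpa using this)

section attach

variable (G : CellComplex X) {J : Type u} (s : J → X → ℝ)

/-- The incidence numbers after attaching 2-cells with signed boundaries `s j`. -/
def attachInc : X ⊕ J → X ⊕ J → ℝ
  | .inl v, .inl z => G.inc v z
  | .inl y, .inr j => s j y
  | .inr _, _ => 0

@[simp] theorem attachInc_inl_inl (v z : X) : attachInc G s (.inl v) (.inl z) = G.inc v z := rfl

@[simp] theorem attachInc_inl_inr (y : X) (j : J) : attachInc G s (.inl y) (.inr j) = s j y := rfl

@[simp] theorem attachInc_inr (j : J) (z : X ⊕ J) : attachInc G s (.inr j) z = 0 := rfl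

variable {G s}

theorem attachInc_ne_zero {v z : X ⊕ J} (h : attachInc G s v z ≠ 0) : ∃ y, v = .inl y := by
  cases v with
  | inl y => exact ⟨y, rfl⟩
  | inr j => exact absurd rfl h

/-- As `G` has no 2-cells and the new cells have no cofaces, every diamond runs from a vertex of `G`
through an edge to a new cell. -/
theorem attach_diamond (hG : G.DimLE 1)
    {v z : X ⊕ J} (h : ∃ y, attachInc G s v y ≠ 0 ∧ attachInc G s y z ≠ 0) :
    ∃ v' j y, v = .inl v' ∧ z = .inr j ∧ G.inc v' y ≠ 0 ∧ s j y ≠ 0 := by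
  obtain ⟨y, h1, h2⟩ := h
  obtain ⟨v, rfl⟩ := attachInc_ne_zero h1
  obtain ⟨y, rfl⟩ := attachInc_ne_zero h2
  cases z with
  | inl z =>
    have := G.dim_eq _ _ h1
    have := G.dim_eq _ _ h2
    have := hG z
    omega
  | inr j => exact ⟨v, j, y, rfl, rfl, h1, h2⟩

variable (G s) [Fintype J]

/-- The 2-dimensional cell complex obtained from a graph `G` by attaching 2-cells along cycles. -/
noncomputable def attach (hG : G.DimLE 1) (x : X) (hs : ∀ j, G.IsCircuit x (s j))
    (hinj : ∀ i j, {y | s i y ≠ 0} = {y | s j y ≠ 0} → i = j) (wt : J → ℝ)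
    (hwt : ∀ j, 0 < wt j) : CellComplex (X ⊕ J) where
  dim := Sum.elim G.dim fun _ => 2
  inc := attachInc G s
  -- The factor `G.m x` cancels the denominator in `δ*` at `x`, so that `wt j` itself becomes the
  -- coefficient in the upper Laplacian.
  m := Sum.elim G.m fun j => wt j * G.m x
  m_pos := by
    rintro (y | j)
    · exact G.m_pos y
    · exact mul_pos (hwt j) (G.m_pos x)
  inc_mem := by
    rintro (v | i) (z | j)
    · exact G.inc_mem v z
    · exact (hs j).mem v
    · exact Or.inr (Or.inl rfl)
    · exact Or.inr (Or.inl rfl)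
  dim_eq := by
    rintro (v | i) (z | j) h
    · exact G.dim_eq v z h
    · have := (hs j).dim_eq v h
      simp [this]
    · exact absurd rfl h
    · exact absurd rfl h
  exists_facet := by
    rintro (z | j) h
    · obtain ⟨y, hy⟩ := G.exists_facet z h
      exact ⟨.inl y, hy⟩
    · refine ⟨.inl x, ?_⟩
      rw [attachInc_inl_inr, (hs j).self_eq]
      exact one_ne_zero
  edge_head := by
    rintro (y | j) h
    · obtain ⟨w, hw, hu⟩ := G.edge_head y h
      refine ⟨.inl w, hw, ?_⟩
      rintro (v | i) hv
      · rw [hu v hv]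
      · exact absurd hv.2 zero_ne_one
    · simp at h
  edge_tail := by
    rintro (y | j) h
    · obtain ⟨w, hw, hu⟩ := G.edge_tail y h
      refine ⟨.inl w, hw, ?_⟩
      rintro (v | i) hv
      · rw [hu v hv]
      · have := hv.2
        norm_num at this
    · simp at h
  diamond_card := by
    intro v z _ h
    obtain ⟨v, j, y, rfl, rfl, h1, h2⟩ := attach_diamond hG h
    have : {y | attachInc G s (.inl v) y ≠ 0 ∧ attachInc G s y (.inr j) ≠ 0}
        = Sum.inl '' {y | G.inc v y ≠ 0 ∧ s j y ≠ 0} := by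
      ext (y | i) <;> simp
    rw [this, Set.ncard_image_of_injective _ Sum.inl_injective]
    exact (hs j).ncard_eq v ⟨y, h1, h2⟩
  diamond_sign := by
    intro v z _ h
    obtain ⟨v, j, y, rfl, rfl, h1, h2⟩ := attach_diamond hG h
    obtain ⟨⟨y, hy⟩, z, hz⟩ := (hs j).diamond_sign ⟨y, h1, h2⟩
    exact ⟨⟨.inl y, hy⟩, .inl z, hz⟩
  boundary_connected := by
    rintro (z | j) hz y y' hy hy'
    · have := hG z
      simp only [Sum.elim_inl] at hz
      omega
    · obtain ⟨y, rfl⟩ := attachInc_ne_zero hy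
      obtain ⟨y', rfl⟩ := attachInc_ne_zero hy'
      set R : X ⊕ J → X ⊕ J → Prop := fun a b =>
        Relation.TransGen (fun c d => attachInc G s c d ≠ 0) a (.inr j) ∧
        Relation.TransGen (fun c d => attachInc G s c d ≠ 0) b (.inr j) ∧
        attachInc G s a b + attachInc G s b a ≠ 0 with hR
      have key := (hs j).connected (fun a b => R (.inl a) (.inl b)) (by
        intro v y hy hv
        have hTy : Relation.TransGen (fun c d => attachInc G s c d ≠ 0) (.inl y) (.inr j) :=
          .single hy
        have hTv : Relation.TransGen (fun c d => attachInc G s c d ≠ 0) (.inl v) (.inr j) :=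
          .head (show attachInc G s (.inl v) (.inl y) ≠ 0 from hv) hTy
        have h0 : G.inc y v = 0 := by
          by_contra h
          have := G.dim_eq _ _ hv
          have := G.dim_eq _ _ h
          omega
        have h1 : G.inc v y + G.inc y v ≠ 0 := by rwa [h0, add_zero]
        exact ⟨⟨hTv, hTy, h1⟩, hTy, hTv, by rwa [add_comm] at h1⟩) y y' hy hy'
      exact key.lift Sum.inl fun _ _ h => h
  eq_of_facets := by
    have hne : ∀ z j, 1 ≤ G.dim z →
        {y | attachInc G s y (.inl z) ≠ 0} ≠ {y | attachInc G s y (.inr j) ≠ 0} := by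
      intro z j hz h
      have h1 : (Sum.inl x : X ⊕ J) ∈ {y | attachInc G s y (.inr j) ≠ 0} := by
        change s j x ≠ 0
        rw [(hs j).self_eq]
        exact one_ne_zero
      rw [← h] at h1
      have h2 := G.dim_eq x z h1
      have h3 := (hs j).dim_eq x (by rw [(hs j).self_eq]; exact one_ne_zero)
      have := hG z
      omega
    rintro (z | j) (z' | j') hz h
    · rw [G.eq_of_facets z z' hz (Set.ext fun y => Set.ext_iff.1 h (.inl y))]
    · exact absurd h (hne z j' hz)
    · refine absurd h.symm (hne z' j ?_)
      by_contra h0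
      have h1 : (Sum.inl x : X ⊕ J) ∈ {y | attachInc G s y (.inr j) ≠ 0} := by
        change s j x ≠ 0
        rw [(hs j).self_eq]
        exact one_ne_zero
      have h2 : G.inc x z' ≠ 0 := (Set.ext_iff.1 h (.inl x)).1 h1
      have := G.dim_eq _ _ h2
      omega
    · rw [hinj j j' (Set.ext fun y => Set.ext_iff.1 h (.inl y))]

variable {s} (hG : G.DimLE 1) (x : X) (hs : ∀ j, G.IsCircuit x (s j))
  (hinj : ∀ i j, {y | s i y ≠ 0} = {y | s j y ≠ 0} → i = j) (wt : J → ℝ) (hwt : ∀ j, 0 < wt j)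

theorem attach_isSkeleton :
    IsSkeleton 1 G (G.attach s hG x hs hinj wt hwt) (Sum.inl : X → X ⊕ J) where
  injective := Sum.inl_injective
  mem_range := by
    rintro (y | j)
    · exact ⟨fun _ => hG y, fun _ => ⟨y, rfl⟩⟩
    · simp [attach]
  dim_eq _ := rfl
  inc_eq _ _ := rfl
  m_eq _ := rfl

theorem attach_dimLE : (G.attach s hG x hs hinj wt hwt).DimLE 2 := by
  rintro (y | j)
  · exact (hG y).trans one_le_two
  · exact le_rfl

theorem attach_upperLap (hx : G.dim x = 1) (y : X) :
    (G.attach s hG x hs hinj wt hwt).upperLap (.inl x) (.inl y) = ∑ j, wt j * s j y := by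
  rw [upperLap, Fintype.sum_sum_type]
  have h0 : ∀ z, G.inc x z = 0 := by
    intro z
    by_contra h
    have := G.dim_eq _ _ h
    have := hG z
    omega
  have h1 := (G.m_pos x).ne'
  simp only [attach, Sum.elim_inl, Sum.elim_inr, attachInc_inl_inl, attachInc_inl_inr, h0,
    mul_zero, Finset.sum_const_zero, zero_add, (hs _).self_eq, mul_one]
  refine Finset.sum_congr rfl fun j _ => ?_
  rw [mul_div_cancel_right₀ _ h1]

/-- The extension of `G` by the 2-cells attached in `attach`. -/
noncomputable def attachExtension {ω : X → ℝ} (hω : ∀ y, 0 < ω y) : G.Extension ω where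
  Y := X ⊕ J
  K := G.attach s hG x hs hinj wt hwt
  ι := Sum.inl
  isSkeleton := G.attach_isSkeleton hG x hs hinj wt hwt
  ω' := Sum.elim ω fun _ => 1
  ω'_pos := by
    rintro (y | j)
    · exact hω y
    · exact one_pos
  ω'_eq _ := rfl

theorem attachExtension_curv [DecidableEq X] {ω : X → ℝ} (hω : ∀ y, 0 < ω y) (hx : G.dim x = 1) :
    (G.attachExtension hG x hs hinj wt hwt hω).curv x =
      G.lowerLap x x + ∑ j, wt j * s j x
        - ∑ y with y ≠ x, ω y / ω x * |G.lowerLap x y + ∑ j, wt j * s j y| := by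
  classical
  have hsk := G.attach_isSkeleton hG x hs hinj wt hwt
  change (G.attach s hG x hs hinj wt hwt).forman (Sum.elim ω fun _ => 1) (.inl x) = _
  rw [forman_eq, hsk.lowerLap_eq, attach_upperLap _ _ _ _ _ _ _ hx]
  congr 1
  rw [Finset.sum_filter, Fintype.sum_sum_type, Finset.sum_filter]
  have h0 : ∀ j, (G.attach s hG x hs hinj wt hwt).lowerLap (.inl x) (.inr j) +
      (G.attach s hG x hs hinj wt hwt).upperLap (.inl x) (.inr j) = 0 := by
    intro j
    have hd : (G.attach s hG x hs hinj wt hwt).dim (.inr j) ≠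
        (G.attach s hG x hs hinj wt hwt).dim (.inl x) := by
      simp [attach, hx]
    rw [lowerLap_eq_zero _ hd, upperLap_eq_zero _ hd, add_zero]
  simp only [h0, abs_zero, mul_zero, ite_self, Finset.sum_const_zero, add_zero, hsk.lowerLap_eq,
    attach_upperLap _ _ _ _ _ _ _ hx, Sum.elim_inl, ne_eq, Sum.inl.injEq]

theorem attach_isShortcutting {ω : X → ℝ} {j : J} (hj : G.IsShort ω x (s j)) :
    (G.attach s hG x hs hinj wt hwt).IsShortcutting (Sum.elim ω fun _ => 1) (.inl x) (.inr j) := by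
  classical
  have hsk := G.attach_isSkeleton hG x hs hinj wt hwt
  refine ⟨rfl, ?_, ?_⟩
  · change s j x ≠ 0
    rw [(hs j).self_eq]
    exact one_ne_zero
  · rw [IsShort] at hj
    simp only [lowerLap_ind]
    rw [Finset.sum_filter, Fintype.sum_sum_type, Finset.sum_filter, Fintype.sum_sum_type]
    simp only [Sum.elim_inl, Sum.elim_inr, hsk.lowerLap_eq]
    rw [Finset.sum_filter, Finset.sum_filter] at hj
    simp only [attach, attachInc_inl_inr, attachInc_inr, ne_eq, not_true_eq_false, false_and,
      if_false, Finset.sum_const_zero, add_zero]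
    exact hj

end attach

/-! ### Attainment and conclusion -/

/-- The Ollivier curvature of an edge is attained as the Forman curvature of a 2-complex all of whose
2-cells are shortcutting. -/
theorem exists_extension_curv_ge {G : CellComplex X} {ω : X → ℝ} (hG : G.DimLE 1)
    (hω : ∀ y, 0 < ω y) (hn : G.NonDegenerate ω) {x : X} (hx : G.dim x = 1) {V : ℝ}
    (hV : ∀ f : X → ℝ, G.coboundary f x = ω x → (∀ y, |G.coboundary f y| ≤ ω y) →
      V ≤ G.coboundary (G.coboundaryAdj (G.coboundary f)) x) :
    ∃ E : G.Extension ω, E.K.DimLE 2 ∧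
      (∀ z, E.K.dim z = 2 → E.K.IsShortcutting E.ω' (E.ι x) z) ∧ V ≤ E.curv x * ω x := by
  classical
  obtain ⟨c, hc, hcV⟩ := exists_weights hω hG hn hx hV
  -- Cell weights must be positive, so cycles with zero multiplier are not attached.
  let J : Type u := {S : G.ShortCycle ω x // 0 < c S}
  have hs : ∀ j : J, G.IsCircuit x j.1.sign := fun j => j.1.isCircuit
  have hinj : ∀ i j : J, {y | i.1.sign y ≠ 0} = {y | j.1.sign y ≠ 0} → i = j := by
    intro i j h
    rw [ShortCycle.support_sign, ShortCycle.support_sign] at h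
    exact Subtype.ext (Subtype.ext h)
  refine ⟨G.attachExtension hG x hs hinj (fun j => c j.1) (fun j => j.2) hω,
    G.attach_dimLE hG x hs hinj _ fun j => j.2, ?_, ?_⟩
  · rintro (y | j) hz
    · have h1 : G.dim y = 2 := hz
      have := hG y
      omega
    · exact G.attach_isShortcutting hG x hs hinj _ (fun j => j.2) j.1.isShort
  · rw [attachExtension_curv _ _ _ _ _ _ _ _ hx]
    have hsum : ∀ y, ∑ j : J, c j.1 * j.1.sign y = ∑ S, c S * S.sign y := by
      intro y
      refine (Finset.sum_subtype (Finset.univ.filter fun S => 0 < c S) (by simp)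
        fun S => c S * S.sign y).symm.trans ?_
      refine Finset.sum_filter_of_ne fun S _ h => ?_
      exact (hc S).lt_of_ne' (left_ne_zero_of_mul h)
    simp only [hsum]
    set D : X → ℝ := fun y => G.lowerLap x y + ∑ S, c S * S.sign y with hD
    have hωx := (hω x).ne'
    -- This `g` minimises the linear form over the box: away from `x` each term becomes `-ω y * |D
    -- y|`, giving exactly the Forman curvature times `ω x`.
    refine (hcV (fun y => if y = x then ω x else -(ω y * SignType.sign (D y))) ?_
      (if_pos rfl)).trans (le_of_eq ?_)
    · intro y
      split_ifs with h
      · rw [h, abs_of_pos (hω x)]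
      · rw [abs_neg, abs_mul, abs_of_pos (hω y)]
        refine mul_le_of_le_one_right (hω y).le ?_
        rcases SignType.sign (D y) with _ | _ | _ <;> simp
    · rw [← Finset.add_sum_erase _ _ (Finset.mem_univ x), if_pos rfl, sub_mul, sub_eq_add_neg,
        Finset.sum_mul, ← Finset.sum_neg_distrib, Finset.filter_ne']
      congr 1
      refine Finset.sum_congr rfl fun y hy => ?_
      rw [if_neg (Finset.ne_of_mem_erase hy)]
      have h1 := self_mul_sign (D y)
      change D y * _ = -(_ * |D y| * _)
      rw [← h1]
      field_simp

/-- The infimum in the definition of the Ollivier curvature is a real number. -/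
theorem exists_ollivier_eq {G : CellComplex X} {ω : X → ℝ}
    (hG : G.DimLE 1) (hω : ∀ y, 0 < ω y) (hn : G.NonDegenerate ω) {x : X} (hx : G.dim x = 1) :
    ∃ V : ℝ, G.ollivier ω x = ((V / ω x : ℝ) : EReal) ∧
      (∀ f : X → ℝ, G.coboundary f x = ω x → (∀ y, |G.coboundary f y| ≤ ω y) →
        V ≤ G.coboundary (G.coboundaryAdj (G.coboundary f)) x) ∧
      ∀ r : ℝ, (∀ f : X → ℝ, G.coboundary f x = ω x → (∀ y, |G.coboundary f y| ≤ ω y) →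
        r ≤ G.coboundary (G.coboundaryAdj (G.coboundary f)) x) → r ≤ V := by
  set P : (X → ℝ) → Prop := fun f => G.coboundary f x = ω x ∧ ∀ y, |G.coboundary f y| ≤ ω y with hP
  set val : (X → ℝ) → ℝ := fun f => G.coboundary (G.coboundaryAdj (G.coboundary f)) x with hval
  set I : EReal := ⨅ (f : X → ℝ) (_ : P f), ((val f : ℝ) : EReal) with hI
  obtain ⟨f₀, h1, h2⟩ := hn.exists_feasible hω hG hx
  have hle : ∀ f, P f → I ≤ (val f : EReal) := fun f hf => iInf₂_le f hf
  have htop : I ≠ ⊤ := ne_top_of_le_ne_top (EReal.coe_ne_top _) (hle f₀ ⟨h1, h2⟩)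
  -- The constraint `|δf| ≤ ω` bounds the objective below by a constant independent of `f`.
  have hbot : I ≠ ⊥ := by
    have : ((-∑ y, |G.lowerLap x y| * ω y : ℝ) : EReal) ≤ I := by
      refine le_iInf₂ fun f hf => ?_
      rw [EReal.coe_le_coe_iff, hval, neg_le]
      dsimp only
      rw [lowerLap_apply, ← Finset.sum_neg_distrib]
      refine Finset.sum_le_sum fun y _ => ?_
      refine (neg_le_abs _).trans ?_
      rw [abs_mul]
      exact mul_le_mul_of_nonneg_left (hf.2 y) (abs_nonneg _)
    exact ne_bot_of_le_ne_bot (EReal.coe_ne_bot _) this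
  have hV : ((I.toReal : ℝ) : EReal) = I := EReal.coe_toReal htop hbot
  refine ⟨I.toReal, ?_, fun f hf1 hf2 => ?_, fun r hr => ?_⟩
  · rw [EReal.coe_div, hV]
    rfl
  · rw [← EReal.coe_le_coe_iff, hV]
    exact hle f ⟨hf1, hf2⟩
  · rw [← EReal.coe_le_coe_iff, hV]
    exact le_iInf₂ fun f hf => EReal.coe_le_coe_iff.2 (hr f hf.1 hf.2)

end CellComplex

theorem mainTheorem12 :
    (∀ (X : Type u) [Fintype X] (G : CellComplex X) (ω : X → ℝ),
      G.DimLE 1 → (∀ x, 0 < ω x) → G.NonDegenerate ω → ∀ x, G.dim x = 1 →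
        IsGreatest {r : EReal | ∃ E : G.Extension ω, r = E.curv x} (G.ollivier ω x) ∧
        IsGreatest {r : EReal | ∃ E : G.Extension ω, E.K.DimLE 2 ∧ r = E.curv x}
          (G.ollivier ω x) ∧
        IsGreatest {r : EReal | ∃ E : G.Extension ω, E.K.DimLE 2 ∧
            (∀ z, E.K.dim z = 2 → E.K.IsShortcutting E.ω' (E.ι x) z) ∧ r = E.curv x}
          (G.ollivier ω x)) ∧
    (∀ (X : Type u) [Fintype X] (K : CellComplex X) (w : X → ℝ),
      (∀ x, 0 < w x) → (∀ x, K.m x = 1 / w x) → ∀ x,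
        K.forman (fun y => √(w y)) x = K.formanOriginal w x / w x ∧
        (K.dim x = 1 → K.Coherent x →
          K.formanOriginal w x = K.formanOriginalEdge w x)) := by
  refine ⟨fun X _ G ω hG hω hn x hx => ?_, fun X _ K w hw hm x =>
    ⟨K.forman_sqrt_eq hw hm x, fun hx hc => K.formanOriginal_eq_edge w hx hc⟩⟩
  obtain ⟨V, hV, hle, hge⟩ := CellComplex.exists_ollivier_eq hG hω hn hx
  have hub : ∀ E : G.Extension ω, E.curv x ≤ V / ω x := fun E =>
    (le_div_iff₀ (hω x)).2 (hge _ fun f h1 h2 => E.curv_mul_le hx f h1 h2)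
  obtain ⟨E, hE2, hEs, hE⟩ := CellComplex.exists_extension_curv_ge hG hω hn hx hle
  have heq : G.ollivier ω x = (E.curv x : EReal) := by
    rw [hV, le_antisymm (hub E) ((div_le_iff₀ (hω x)).2 hE)]
  have hub' : ∀ E : G.Extension ω, (E.curv x : EReal) ≤ G.ollivier ω x := fun E => by
    rw [hV]
    exact EReal.coe_le_coe_iff.2 (hub E)
  refine ⟨⟨⟨E, heq⟩, ?_⟩, ⟨⟨E, hE2, heq⟩, ?_⟩, ⟨⟨E, hE2, hEs, heq⟩, ?_⟩⟩
  · rintro r ⟨E', rfl⟩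
    exact hub' E'
  · rintro r ⟨E', -, rfl⟩
    exact hub' E'
  · rintro r ⟨E', -, -, rfl⟩
    exact hub' E'
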